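/- Let $c,g,d\ge 1$ be integers and let $P=(P(i,j))_{i,j\in\mathbb N}$ be a Markov kernel on $\mathbb N$ such that (i) $\sum_{j=0}^{c}P(i,j)=1$ for every $i\in\{0,\dots,g-1\}$; (ii) for every $i\ge g$, $P(i,j)=a_{j-i}(i)$ if $i-g\le j\le i+d$ and $P(i,j)=0$ otherwise, where $(a_{-g}(i),\dots,a_d(i))\in[0,1]^{g+d+1}$ and $\sum_{k=-g}^{d}a_k(i)=1$. Assume that $\lim_{n}a_k(n)=a_k\in[0,1]$ for every integer $-g\le k\le d$, and let $\gamma>1$ be such that $\phi(\gamma):=\sum_{k=-g}^{d}a_k\gamma^k<1$. Put $V_\gamma(n)=\gamma^n$, let $\mathcal B_\gamma$ be the space of all $f:\mathbb N\to\mathbb C$ with $\|f\|_\gamma:=\sup_n\gamma^{-n}|f(n)|<\infty$, and put $(Pf)(i)=\sum_jP(i,j)f(j)$. For $\delta\in(0,1)$ say that $P$ satisfies (WD) with $\delta$ if there are $N\ge1$ and $b\in(0,\infty)$ with $P^NV_\gamma\le\delta^NV_\gamma+b$ on $\mathbb N$; let $\delta_{V_\gamma}(P)$ be the infimum of the $\delta\in[0,1)$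 for which such $N$ and $b$ exist. Let $L:=\inf_{N\ge1}\ell_N^{1/N}$, where $\ell_N:=\limsup_n (P^NV_\gamma)(n)/V_\gamma(n)$. Then: 1. $P$ satisfies (WD) with optimal rate $\phi(\gamma)$: it satisfies (WD) with every $\delta\in(\phi(\gamma),1)$, and $\delta_{V_\gamma}(P)=\phi(\gamma)$. Moreover, if $\sum_{k=-g}^{d}a_k(n)\gamma^k\le\phi(\gamma)$ for all sufficiently large $n$ (in particular if $a_k(n)=a_k$ for all $k$ and all $n\ge g$), then $P$ satisfies (WD) with $\delta=\phi(\gamma)$ itself. 2. $P$ defines a bounded linear operator on $\mathcal B_\gamma$ which is power-bounded, that is $\sup_{n\ge1}\|P^n\|<\infty$, and quasi-compact, with $r_{ess}(P)=L=\phi(\gamma)$. Here $P$ is quasi-compact if, for some $r_0\in(0,1)$, there are $m\ge1$, $\lambda_1,\dots,\lambda_m\in\mathbb C$ and $p_1,\dots,p_m\ge1$ such that $$\mathcal B_\gamma=\bigoplus_{i=1}^m\ker(P-\lambda_iI)^{p_i}\oplus H,\qquad |\lambda_i|\ge r_0,\qquad 1\le\dim\ker(P-\lambda_iI)^{p_i}<\infty,$$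 where $H$ is a closed $P$-invariant subspace with $\inf_{n\ge1}\big(\sup_{h\in H,\|h\|\le1}\|P^nh\|\big)^{1/n}<r_0$; and $r_{ess}(P)$ is the infimum of all such $r_0\in(0,1)$. -/

import Mathlib

open scoped ENNReal
open Filter Topology

noncomputable section

namespace MarkovSpectral

/-! ### Weighted-supremum spaces on `ℕ` -/

/-- A weight function `V : ℕ → [1, +∞)`. -/
structure Weight where
  /-- the underlying function -/
  toFun : ℕ → ℝ
  one_le : ∀ n, 1 ≤ toFun n

instance : CoeFun Weight (fun _ => ℕ → ℝ) := ⟨Weight.toFun⟩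

theorem Weight.pos (V : Weight) (n : ℕ) : 0 < V n := lt_of_lt_of_le one_pos (V.one_le n)

/-- The geometric weight `V_γ(n) = γ ^ n`, for `γ > 1`. -/
def geomWeight (γ : ℝ) (hγ : 1 < γ) : Weight where
  toFun n := γ ^ n
  one_le _ := one_le_pow₀ hγ.le

/-- The linear subspace of all `f : ℕ → ℂ` with `sup_n |f n| / V n < ∞`. -/
def boundedSubmodule (V : Weight) : Submodule ℂ (ℕ → ℂ) where
  carrier := {f | BddAbove (Set.range fun n => ‖f n‖ / V n)}
  zero_mem' := ⟨0, by rintro _ ⟨n, rfl⟩; simp⟩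
  add_mem' := by
    rintro f g ⟨A, hA⟩ ⟨B, hB⟩
    refine ⟨A + B, ?_⟩
    rintro _ ⟨n, rfl⟩
    have h1 : ‖f n‖ / V n ≤ A := hA ⟨n, rfl⟩
    have h2 : ‖g n‖ / V n ≤ B := hB ⟨n, rfl⟩
    calc ‖(f + g) n‖ / V n ≤ (‖f n‖ + ‖g n‖) / V n :=
          div_le_div_of_nonneg_right (norm_add_le _ _) (V.pos n).le
      _ = ‖f n‖ / V n + ‖g n‖ / V n := add_div _ _ _
      _ ≤ A + B := add_le_add h1 h2
  smul_mem' := by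
    rintro z f ⟨A, hA⟩
    refine ⟨‖z‖ * A, ?_⟩
    rintro _ ⟨n, rfl⟩
    have h1 : ‖f n‖ / V n ≤ A := hA ⟨n, rfl⟩
    calc ‖(z • f) n‖ / V n = ‖z‖ * (‖f n‖ / V n) := by
          simp [mul_div_assoc]
      _ ≤ ‖z‖ * A := mul_le_mul_of_nonneg_left h1 (norm_nonneg _)

/-- The space `B_V` of all `f : ℕ → ℂ` with `sup_n |f n| / V n < ∞`. It is a type of its own, so
that its topology is the one of the norm below and not the one of pointwise convergence. -/
def BSpace (V : Weight) : Type := boundedSubmodule V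

namespace BSpace

variable {V : Weight}

instance : AddCommGroup (BSpace V) := inferInstanceAs (AddCommGroup (boundedSubmodule V))

instance : Module ℂ (BSpace V) := inferInstanceAs (Module ℂ (boundedSubmodule V))

instance : CoeFun (BSpace V) (fun _ => ℕ → ℂ) := ⟨fun f => f.1⟩

/-- The weighted supremum norm `‖f‖_V = sup_n |f n| / V n`. -/
instance : Norm (BSpace V) := ⟨fun f => ⨆ n, ‖f n‖ / V n⟩

theorem norm_def (f : BSpace V) : ‖f‖ = ⨆ n, ‖f n‖ / V n := rfl

theorem le_norm (f : BSpace V) (n : ℕ) : ‖f n‖ / V n ≤ ‖f‖ := le_ciSup f.2 n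

theorem norm_core : NormedSpace.Core ℂ (BSpace V) where
  norm_nonneg f := Real.iSup_nonneg fun n => div_nonneg (norm_nonneg _) (V.pos n).le
  norm_smul z f := by
    rw [norm_def, norm_def, Real.mul_iSup_of_nonneg (norm_nonneg z)]
    refine iSup_congr fun n => ?_
    have h : (z • f) n = z * f n := rfl
    rw [h, norm_mul, mul_div_assoc]
  norm_triangle f g := by
    refine ciSup_le fun n => ?_
    have h : (f + g) n = f n + g n := rfl
    calc ‖(f + g) n‖ / V n ≤ (‖f n‖ + ‖g n‖) / V n := by
          rw [h]; exact div_le_div_of_nonneg_right (norm_add_le _ _) (V.pos n).le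
      _ = ‖f n‖ / V n + ‖g n‖ / V n := add_div _ _ _
      _ ≤ ‖f‖ + ‖g‖ := add_le_add (le_norm f n) (le_norm g n)
  norm_eq_zero_iff f := by
    constructor
    · intro hf
      refine Subtype.ext (funext fun n => ?_)
      have h1 : ‖f n‖ / V n ≤ 0 := hf ▸ le_norm f n
      have h2 : ‖f n‖ ≤ 0 := by
        by_contra hc
        exact absurd h1 (not_le.2 (div_pos (not_le.1 hc) (V.pos n)))
      exact norm_le_zero_iff.1 h2
    · rintro rfl
      have h : ∀ n, (0 : BSpace V) n = 0 := fun _ => rfl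
      simp [norm_def, h]

instance : NormedAddCommGroup (BSpace V) := NormedAddCommGroup.ofCore norm_core

instance : NormedSpace ℂ (BSpace V) := NormedSpace.ofCore norm_core

end BSpace

/-! ### Power-boundedness, quasi-compactness, essential spectral radius -/

section Operators

variable {E : Type*} [NormedAddCommGroup E] [NormedSpace ℂ E]

/-- `sup_{n ≥ 1} ‖T ^ n‖ < ∞`. -/
def PowerBounded (T : E →L[ℂ] E) : Prop := ∃ C : ℝ, ∀ n : ℕ, 1 ≤ n → ‖T ^ n‖ ≤ C

/-- The decomposition at level `r₀` that defines quasi-compactness: the space is the direct sum of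
`ker (T - λ_i I) ^ p_i`, `i = 1, …, m`, with `m, p_i ≥ 1`, and of a closed `T`-invariant subspace
`H`, where `|λ_i| ≥ r₀`, the kernels are of finite dimension `≥ 1`, and
`inf_{n ≥ 1} ‖T ^ n |_H‖ ^ (1 / n) < r₀`. -/
def QuasiCompactAt (T : E →L[ℂ] E) (r₀ : ℝ) : Prop :=
  ∃ (m : ℕ) (lam : Fin m → ℂ) (p : Fin m → ℕ) (H : Submodule ℂ E),
    1 ≤ m ∧ (∀ i, 1 ≤ p i) ∧
    DirectSum.IsInternal (fun o : Option (Fin m) =>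
      o.elim H (fun i =>
        LinearMap.ker (((T : E →ₗ[ℂ] E) - lam i • (LinearMap.id : E →ₗ[ℂ] E)) ^ p i))) ∧
    (∀ i, r₀ ≤ ‖lam i‖ ∧
      FiniteDimensional ℂ
        (LinearMap.ker (((T : E →ₗ[ℂ] E) - lam i • (LinearMap.id : E →ₗ[ℂ] E)) ^ p i)) ∧
      1 ≤ Module.finrank ℂ
        (LinearMap.ker (((T : E →ₗ[ℂ] E) - lam i • (LinearMap.id : E →ₗ[ℂ] E)) ^ p i))) ∧
    IsClosed (H : Set E) ∧ (∀ h ∈ H, T h ∈ H) ∧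
    (⨅ n : ℕ+, ‖(T ^ (n : ℕ)).comp H.subtypeL‖ ^ (1 / ((n : ℕ) : ℝ))) < r₀

/-- `T` is quasi-compact: the decomposition exists at some level `r₀ ∈ (0, 1)`. -/
def QuasiCompact (T : E →L[ℂ] E) : Prop :=
  ∃ r₀ : ℝ, 0 < r₀ ∧ r₀ < 1 ∧ QuasiCompactAt T r₀

/-- The essential spectral radius of a quasi-compact operator, as the infimum of the levels
`r₀ ∈ (0, 1)` at which the decomposition exists. -/
def essSpectralRadius (T : E →L[ℂ] E) : ℝ :=
  sInf {r₀ : ℝ | 0 < r₀ ∧ r₀ < 1 ∧ QuasiCompactAt T r₀}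

end Operators

/-! ### Markov kernels on `ℕ` and the weak drift condition -/

/-- `P = (P(i,j))` is a Markov kernel on `ℕ`. -/
structure IsMarkov (P : ℕ → ℕ → ℝ) : Prop where
  nonneg : ∀ i j, 0 ≤ P i j
  hasSum_one : ∀ i, HasSum (P i) 1

/-- The action `(P f)(i) = ∑_j P(i,j) f(j)` on functions `f : ℕ → [0, +∞]`. -/
def act (P : ℕ → ℕ → ℝ) (f : ℕ → ℝ≥0∞) : ℕ → ℝ≥0∞ :=
  fun i => ∑' j, ENNReal.ofReal (P i j) * f j

/-- `P ^ N V`, as a function with values in `[0, +∞]`. -/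
def powAct (P : ℕ → ℕ → ℝ) (V : Weight) (N : ℕ) : ℕ → ℝ≥0∞ :=
  (act P)^[N] (fun n => ENNReal.ofReal (V n))

/-- There are `N ≥ 1` and `b ∈ (0, +∞)` with `P ^ N V ≤ δ ^ N V + b`. -/
def DriftBound (P : ℕ → ℕ → ℝ) (V : Weight) (δ : ℝ) : Prop :=
  ∃ N : ℕ, 1 ≤ N ∧ ∃ b : ℝ, 0 < b ∧
    ∀ n, powAct P V N n ≤ ENNReal.ofReal (δ ^ N * V n + b)

/-- The weak drift condition with the given constant `δ ∈ (0, 1)`. -/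
def WeakDrift (P : ℕ → ℕ → ℝ) (V : Weight) (δ : ℝ) : Prop :=
  0 < δ ∧ δ < 1 ∧ DriftBound P V δ

/-- `δ_V(P)`, the infimum of the `δ ∈ [0, 1)` for which the drift inequality holds. -/
def driftInf (P : ℕ → ℕ → ℝ) (V : Weight) : ℝ :=
  sInf {δ : ℝ | 0 ≤ δ ∧ δ < 1 ∧ DriftBound P V δ}

/-- `ℓ_N = limsup_n (P ^ N V)(n) / V(n)`. -/
def driftLimsup (P : ℕ → ℕ → ℝ) (V : Weight) (N : ℕ) : ℝ≥0∞ :=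
  limsup (fun n => powAct P V N n / ENNReal.ofReal (V n)) atTop

/-- `L = inf_{N ≥ 1} ℓ_N ^ (1 / N)`. -/
def driftL (P : ℕ → ℕ → ℝ) (V : Weight) : ℝ≥0∞ :=
  ⨅ N : ℕ+, driftLimsup P V N ^ (1 / ((N : ℕ) : ℝ))

/-- The bounded operator `T` on `B_V` is the action of `P`: `(T f)(i) = ∑_j P(i,j) f(j)`, the
series being convergent. There is at most one such `T`. -/
def IsActionOf {V : Weight} (P : ℕ → ℕ → ℝ) (T : BSpace V →L[ℂ] BSpace V) : Prop :=
  ∀ (f : BSpace V) (i : ℕ), HasSum (fun j => (P i j : ℂ) * f j) (T f i)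

/-! ### Random walks with bounded state-dependent increments -/

/-- `P` is the Markov kernel of a random walk on `ℕ` with bounded state-dependent increments: from
a state `i < g` it stays in `{0, …, c}`, and from a state `i ≥ g` it makes the increment
`k ∈ {-g, …, d}` with probability `a k i`. -/
structure IsBoundedIncrementWalk (c g d : ℕ) (P : ℕ → ℕ → ℝ) (a : ℤ → ℕ → ℝ) : Prop where
  markov : IsMarkov P
  boundary : ∀ i < g, ∑ j ∈ Finset.range (c + 1), P i j = 1
  coeff_mem : ∀ i ≥ g, ∀ k ∈ Finset.Icc (-(g : ℤ)) (d : ℤ), a k i ∈ Set.Icc (0 : ℝ) 1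
  coeff_sum : ∀ i ≥ g, ∑ k ∈ Finset.Icc (-(g : ℤ)) (d : ℤ), a k i = 1
  interior : ∀ i ≥ g, ∀ j : ℕ, P i j =
    if (i : ℤ) - g ≤ j ∧ (j : ℤ) ≤ i + d then a ((j : ℤ) - i) i else 0

/-- `φ(γ) = ∑_{k=-g}^{d} α_k γ ^ k`. -/
def phi (g d : ℕ) (α : ℤ → ℝ) (γ : ℝ) : ℝ :=
  ∑ k ∈ Finset.Icc (-(g : ℤ)) (d : ℤ), α k * γ ^ k

end MarkovSpectral

end

open MarkovSpectral

/-! The proof rests on one limit. From a state `i ≥ g`, conditioning on the first step writes the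
ratio `P ^ (n+1) V / V` at `i` as the sum of `a k i * γ ^ k` times the ratio `P ^ n V / V` at `i +
k`. By induction the ratios tend to `φ(γ) ^ n` (`tendsto_bandIter_div`). So every `ℓ_N` is `φ(γ) ^
N`, and a drift inequality forces `φ(γ) ≤ δ`. Conversely, for `δ > φ(γ)`, one step suffices, the
finitely many exceptional states being absorbed in `b`.

For `r_ess ≤ φ(γ)`, take `r₀ > φ(γ)` and `N` large. Cutting `P ^ N f` off to finitely many states
gives `T ^ N = K + R` with `K` of finite rank and `2‖R‖ < r₀ ^ N`. A Riesz–Schauder argument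
follows: kernels of products of factors `T ^ N - z`, `|z| ≥ r₀ ^ N`, cannot grow forever
(`exists_stable_outerPoly`). A product with maximal kernel is an invertible operator plus one of
finite rank, so its kernel and range are complementary (`isCompl_ker_range_of_unit_add`). The kernel
is a finite sum of generalized eigenspaces of `T`; on the range all `T ^ N - z` are bijective, and
Gelfand's formula bounds the powers there.

For `r_ess ≥ φ(γ)`, the subspace `H` of any decomposition has finite codimension, so it contains a
nonzero combination of copies of `V` cut to long, remote blocks. In the middle of a block `P ^ n`
cannot distinguish it from a multiple of `V`, whence `‖T ^ n |_H‖ ≥ φ(γ) ^ n`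
(`le_norm_bandOp_pow_comp`). -/

namespace MarkovSpectral

open Polynomial

/-! ### Riesz–Schauder theory: stabilization of kernels -/

section Riesz

variable {E : Type*} [NormedAddCommGroup E] [NormedSpace ℂ E]

/-- The monic polynomials all of whose roots have modulus at least `r`. -/
noncomputable def outerPolys (r : ℝ) : Submonoid ℂ[X] :=
  Submonoid.closure {Q | ∃ z : ℂ, r ≤ ‖z‖ ∧ Q = X - C z}

theorem X_sub_C_mem_outerPolys {r : ℝ} {z : ℂ} (hz : r ≤ ‖z‖) : X - C z ∈ outerPolys r :=
  Submonoid.subset_closure ⟨z, hz, rfl⟩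

theorem norm_root_of_mem_outerPolys {r : ℝ} {Q : ℂ[X]} (hQ : Q ∈ outerPolys r) {w : ℂ}
    (hw : Q.eval w = 0) : r ≤ ‖w‖ := by
  induction hQ using Submonoid.closure_induction with
  | mem Q h =>
    obtain ⟨z, hz, rfl⟩ := h
    have : w = z := by simpa [sub_eq_zero] using hw
    rwa [this]
  | one => simp at hw
  | mul P Q _ _ hP hQ =>
    rw [eval_mul, mul_eq_zero] at hw
    exact hw.elim hP hQ

theorem aeval_mul_apply (S : E →L[ℂ] E) (P Q : ℂ[X]) (x : E) :
    aeval S (P * Q) x = aeval S P (aeval S Q x) := by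
  rw [map_mul]; rfl

theorem aeval_mul_apply' (S : E →L[ℂ] E) (P Q : ℂ[X]) (x : E) :
    aeval S (P * Q) x = aeval S Q (aeval S P x) := by
  rw [mul_comm, aeval_mul_apply]

theorem aeval_X_sub_C_apply (S : E →L[ℂ] E) (z : ℂ) (x : E) :
    aeval S (X - C z) x = S x - z • x := by
  simp [Algebra.algebraMap_eq_smul_one]

theorem aeval_apply_eq_zero_of_dvd {S : E →L[ℂ] E} {P Q : ℂ[X]} (h : P ∣ Q) {x : E}
    (hx : aeval S P x = 0) : aeval S Q x = 0 := by
  obtain ⟨A, rfl⟩ := h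
  rw [aeval_mul_apply', hx, map_zero]

/-- A nearly orthogonal unit vector in a kernel strictly larger than a smaller kernel. -/
theorem exists_unit_far_of_ker_lt (A B : E →L[ℂ] E) (hAB : ∃ x, B x = 0 ∧ A x ≠ 0) {θ : ℝ}
    (hθ : θ < 1) :
    ∃ x, B x = 0 ∧ ‖x‖ ≤ 1 ∧ ∀ y, B y = 0 → A y = 0 → θ ≤ ‖x - y‖ := by
  obtain ⟨x₀, hB, hA⟩ := hAB
  let W : Submodule ℂ E := LinearMap.ker (B : E →ₗ[ℂ] E)
  let A' : W →L[ℂ] E := A.comp W.subtypeL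
  obtain ⟨x, hx, hfar⟩ := riesz_lemma (𝕜 := ℂ) (F := LinearMap.ker (A' : W →ₗ[ℂ] E))
    A'.isClosed_ker ⟨⟨x₀, hB⟩, hA⟩ hθ
  have hx0 : x ≠ 0 := by rintro rfl; exact hx (Submodule.zero_mem _)
  have hn : 0 < ‖x‖ := norm_pos_iff.2 hx0
  have hxB : B (x : E) = 0 := x.2
  refine ⟨((‖x‖⁻¹ : ℝ) : ℂ) • (x : E), by rw [map_smul, hxB, smul_zero], ?_, fun y hyB hyA => ?_⟩
  · rw [norm_smul]
    simp only [Complex.norm_real, norm_inv, norm_norm]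
    exact (inv_mul_cancel₀ hn.ne').le
  · let y' : W := ((‖x‖ : ℝ) : ℂ) • ⟨y, hyB⟩
    have hy' : y' ∈ LinearMap.ker (A' : W →ₗ[ℂ] E) := by
      change A (((‖x‖ : ℝ) : ℂ) • y) = 0
      rw [map_smul, hyA, smul_zero]
    have h := hfar y' hy'
    have e : x - y' = ((‖x‖ : ℝ) : ℂ) • (⟨((‖x‖⁻¹ : ℝ) : ℂ) • (x : E) - y,
        W.sub_mem (W.smul_mem _ x.2) hyB⟩ : W) := by
      ext
      change (x : E) - ((‖x‖ : ℝ) : ℂ) • y = ((‖x‖ : ℝ) : ℂ) • (((‖x‖⁻¹ : ℝ) : ℂ) • (x : E) - y)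
      rw [smul_sub, smul_smul, ← Complex.ofReal_mul, mul_inv_cancel₀ hn.ne']
      simp
    rw [e, norm_smul, Complex.norm_real, norm_norm, mul_comm] at h
    exact le_of_mul_le_mul_left h hn

/-- For a small perturbation of a finite rank operator, kernels of polynomials with roots outside
a disc cannot grow indefinitely. -/
theorem exists_stable_outerPoly {S K R : E →L[ℂ] E} (hS : S = K + R)
    [FiniteDimensional ℂ (LinearMap.range (K : E →ₗ[ℂ] E))] {r : ℝ} (hR : 2 * ‖R‖ < r) :
    ∃ Q ∈ outerPolys r, ∀ z : ℂ, r ≤ ‖z‖ → ∀ x,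
      aeval S (Q * (X - C z)) x = 0 → aeval S Q x = 0 := by
  by_contra! hcon
  have hr : 0 < r := lt_of_le_of_lt (by positivity) hR
  -- This choice makes `r * θ - 2 * ‖R‖`, the separation obtained below, positive.
  obtain ⟨θ, hθ1, hθ2⟩ : ∃ θ, 2 * ‖R‖ / r < θ ∧ θ < 1 := exists_between ((div_lt_one hr).2 hR)
  rw [div_lt_iff₀ hr] at hθ1
  have key : ∀ Q : outerPolys r, ∃ z : ℂ, ∃ x : E, r ≤ ‖z‖ ∧
      aeval S ((Q : ℂ[X]) * (X - C z)) x = 0 ∧ ‖x‖ ≤ 1 ∧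
      ∀ y, aeval S (Q : ℂ[X]) y = 0 → θ ≤ ‖x - y‖ := by
    rintro ⟨Q, hQ⟩
    obtain ⟨z, hz, x, hx, hx'⟩ := hcon Q hQ
    obtain ⟨u, hu, hu1, hu2⟩ := exists_unit_far_of_ker_lt (aeval S Q)
      (aeval S (Q * (X - C z))) ⟨x, hx, hx'⟩ hθ2
    exact ⟨z, u, hz, hu, hu1, fun y hy =>
      hu2 y (aeval_apply_eq_zero_of_dvd (Dvd.intro _ rfl) hy) hy⟩
  choose z x hz hx hx1 hfar using key
  let next : outerPolys r → outerPolys r := fun Q =>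
    ⟨(Q : ℂ[X]) * (X - C (z Q)), mul_mem Q.2 (X_sub_C_mem_outerPolys (hz Q))⟩
  let Qs : ℕ → outerPolys r := fun n => next^[n] 1
  have hQs : ∀ n, Qs (n + 1) = next (Qs n) := fun n => Function.iterate_succ_apply' _ _ _
  have hdvd : ∀ m n, m ≤ n → ((Qs m : outerPolys r) : ℂ[X]) ∣ (Qs n : outerPolys r) := by
    intro m n hmn
    induction n, hmn using Nat.le_induction with
    | base => exact dvd_rfl
    | succ n _ ih => rw [hQs]; exact ih.trans (Dvd.intro _ rfl)
  have hker : ∀ m n, m < n → aeval S ((Qs n : outerPolys r) : ℂ[X]) (x (Qs m)) = 0 := by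
    intro m n hmn
    refine aeval_apply_eq_zero_of_dvd (hdvd (m + 1) n hmn) ?_
    rw [hQs]
    exact hx (Qs m)
  have hsep : ∀ m n, m < n → r * θ - 2 * ‖R‖ ≤ ‖K (x (Qs n)) - K (x (Qs m))‖ := by
    intro m n hmn
    set u := x (Qs n) with hu
    set v := x (Qs m) with hv
    have hz0 : z (Qs n) ≠ 0 := by
      rw [← norm_pos_iff]; exact hr.trans_le (hz _)
    -- Both `S v` and `(S - z) u` are killed by the `n`-th polynomial, hence so is `y`. As `S u - S
    -- v = z (u - y)`, the distance of `u` to that kernel separates the images.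
    set y : E := (z (Qs n))⁻¹ • (S v - aeval S (X - C (z (Qs n))) u) with hy
    have hy0 : aeval S ((Qs n : outerPolys r) : ℂ[X]) y = 0 := by
      rw [hy, map_smul, map_sub, ← aeval_mul_apply, hx (Qs n), sub_zero]
      have h1 : aeval S ((Qs n : outerPolys r) : ℂ[X]) (S v)
          = aeval S (((Qs n : outerPolys r) : ℂ[X]) * X) v := by
        rw [aeval_mul_apply, aeval_X]
      rw [h1, aeval_apply_eq_zero_of_dvd (Dvd.intro _ rfl) (hker m n hmn), smul_zero]
    have h2 : S u - S v = z (Qs n) • (u - y) := by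
      rw [hy, smul_sub, smul_smul, mul_inv_cancel₀ hz0, one_smul, aeval_X_sub_C_apply]
      abel
    have h3 : r * θ ≤ ‖S u - S v‖ := by
      rw [h2, norm_smul]
      have h0 : 0 ≤ θ := by
        by_contra h
        have := mul_neg_of_neg_of_pos (not_le.1 h) hr
        have := norm_nonneg R
        linarith
      exact mul_le_mul (hz _) (hfar _ _ hy0) h0 (norm_nonneg _)
    have h4 : S u - S v = (K u - K v) + (R u - R v) := by
      rw [hS]; simp only [add_apply]; abel
    have h5 : ‖R u - R v‖ ≤ 2 * ‖R‖ := by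
      have hu1 : ‖R u‖ ≤ ‖R‖ := R.le_of_opNorm_le_of_le le_rfl (hx1 (Qs n)) |>.trans (by simp)
      have hv1 : ‖R v‖ ≤ ‖R‖ := R.le_of_opNorm_le_of_le le_rfl (hx1 (Qs m)) |>.trans (by simp)
      linarith [norm_sub_le (R u) (R v)]
    rw [h4] at h3
    linarith [norm_add_le (K u - K v) (R u - R v)]
  -- The vectors `K x_n` are bounded in a finite dimensional space, so some subsequence is Cauchy,
  -- against the uniform separation.
  let w : ℕ → LinearMap.range (K : E →ₗ[ℂ] E) := fun n => ⟨K (x (Qs n)), x (Qs n), rfl⟩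
  have : ProperSpace (LinearMap.range (K : E →ₗ[ℂ] E)) := FiniteDimensional.proper ℂ _
  obtain ⟨a, -, φ, hφ, hlim⟩ := tendsto_subseq_of_bounded
    (Metric.isBounded_closedBall (x := (0 : LinearMap.range (K : E →ₗ[ℂ] E))) (r := ‖K‖))
    (x := w) (fun n => by
      rw [mem_closedBall_zero_iff]
      change ‖K (x (Qs n))‖ ≤ ‖K‖
      exact K.le_of_opNorm_le_of_le le_rfl (hx1 (Qs n)) |>.trans (by simp))
  obtain ⟨n₀, hn₀⟩ := Metric.cauchySeq_iff'.1 hlim.cauchySeq (r * θ - 2 * ‖R‖) (by linarith)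
  have h1 := hn₀ (n₀ + 1) (Nat.le_succ _)
  have h2 := hsep (φ n₀) (φ (n₀ + 1)) (hφ (Nat.lt_succ_self _))
  rw [dist_eq_norm] at h1
  exact absurd h1 (not_lt.2 h2)

/-- The stability of the kernel at a maximal polynomial passes to all multiples. -/
theorem ker_mul_outerPoly_le {S : E →L[ℂ] E} {r : ℝ} {Q : ℂ[X]}
    (hQ : ∀ z : ℂ, r ≤ ‖z‖ → ∀ x, aeval S (Q * (X - C z)) x = 0 → aeval S Q x = 0)
    {Q' : ℂ[X]} (hQ' : Q' ∈ outerPolys r) (x : E) (hx : aeval S (Q * Q') x = 0) :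
    aeval S Q x = 0 := by
  induction hQ' using Submonoid.closure_induction generalizing x with
  | mem A h =>
    obtain ⟨z, hz, rfl⟩ := h
    exact hQ z hz x hx
  | one => simpa using hx
  | mul A B _ _ hA hB =>
    rw [← mul_assoc, aeval_mul_apply] at hx
    refine hB x ?_
    rw [aeval_mul_apply]
    refine hA _ ?_
    exact hx

end Riesz

/-! ### Fredholm alternative modulo finite rank, and Gelfand's formula -/

section Fredholm

variable {E : Type*} [NormedAddCommGroup E] [NormedSpace ℂ E]

/-- An invertible operator perturbed by one of finite rank, with `ker A ^ 2 = ker A`, splits the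
space into its kernel and its range. -/
theorem isCompl_ker_range_of_unit_add {A G : E →L[ℂ] E} (U : (E →L[ℂ] E)ˣ) (hA : A = U + G)
    [FiniteDimensional ℂ (LinearMap.range (G : E →ₗ[ℂ] E))]
    (h2 : ∀ x, A (A x) = 0 → A x = 0) :
    FiniteDimensional ℂ (LinearMap.ker (A : E →ₗ[ℂ] E)) ∧
      IsCompl (LinearMap.ker (A : E →ₗ[ℂ] E)) (LinearMap.range (A : E →ₗ[ℂ] E)) := by
  set V : E →L[ℂ] E := ((U⁻¹ : (E →L[ℂ] E)ˣ) : E →L[ℂ] E) with hV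
  have hVU : ∀ x, V ((U : E →L[ℂ] E) x) = x := fun x =>
    DFunLike.congr_fun (Units.inv_mul U) x
  have hUV : ∀ x, (U : E →L[ℂ] E) (V x) = x := fun x =>
    DFunLike.congr_fun (Units.mul_inv U) x
  have hAx : ∀ x, A x = (U : E →L[ℂ] E) x + G x := fun x => by rw [hA]; rfl
  set W := LinearMap.range (G : E →ₗ[ℂ] E) with hW
  set N := LinearMap.ker (A : E →ₗ[ℂ] E) with hN
  set H := LinearMap.range (A : E →ₗ[ℂ] E) with hH
  -- `U` maps the kernel into the range of `G`
  have hNW : ∀ x ∈ N, (U : E →L[ℂ] E) x ∈ W := by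
    intro x hx
    have hx0 : A x = 0 := hx
    rw [hAx] at hx0
    rw [eq_neg_of_add_eq_zero_left hx0]
    exact W.neg_mem ⟨x, rfl⟩
  have hNfin : FiniteDimensional ℂ N := by
    let f : N →ₗ[ℂ] W := ((U : E →L[ℂ] E) : E →ₗ[ℂ] E).restrict hNW
    refine FiniteDimensional.of_injective f fun x y hxy => Subtype.ext ?_
    have : (U : E →L[ℂ] E) x = (U : E →L[ℂ] E) y := congrArg Subtype.val hxy
    rw [← hVU x, this, hVU]
  refine ⟨hNfin, ?_⟩
  have hdisj : Disjoint N H := by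
    rw [Submodule.disjoint_def]
    rintro _ hx ⟨y, rfl⟩
    exact h2 y hx
  -- `w ↦ A (V w) = w + G (V w)` acts on the range of `G`
  let B : W →ₗ[ℂ] W := ((A.comp V : E →L[ℂ] E) : E →ₗ[ℂ] E).restrict (by
    intro w hw
    change A (V w) ∈ W
    rw [hAx, hUV]
    exact W.add_mem hw ⟨V w, rfl⟩)
  have hBker : Module.finrank ℂ (LinearMap.ker B) ≤ Module.finrank ℂ N := by
    let j : LinearMap.ker B →ₗ[ℂ] N :=
      ((V : E →ₗ[ℂ] E).comp (W.subtype.comp (LinearMap.ker B).subtype)).codRestrict N (by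
        intro w
        exact congrArg Subtype.val w.2)
    refine LinearMap.finrank_le_finrank_of_injective (f := j) fun x y hxy => ?_
    have h1 : V ((x : W) : E) = V ((y : W) : E) := congrArg Subtype.val hxy
    refine Subtype.ext (Subtype.ext ?_)
    rw [← hUV ((x : W) : E), h1, hUV]
  let f : W →ₗ[ℂ] E ⧸ H := H.mkQ.comp W.subtype
  have hf : Function.Surjective f := by
    intro q
    obtain ⟨y, rfl⟩ := H.mkQ_surjective q
    refine ⟨-⟨G (V y), V y, rfl⟩, ?_⟩
    change H.mkQ (-(G (V y))) = H.mkQ y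
    rw [← sub_eq_zero, ← map_sub, Submodule.mkQ_apply, Submodule.Quotient.mk_eq_zero]
    refine ⟨-V y, ?_⟩
    change A (-V y) = _
    rw [map_neg, hAx, hUV]
    abel
  have : FiniteDimensional ℂ (E ⧸ H) := Module.Finite.of_surjective f hf
  have hBf : LinearMap.range B ≤ LinearMap.ker f := by
    rintro _ ⟨w, rfl⟩
    change H.mkQ (A (V w)) = 0
    rw [Submodule.mkQ_apply, Submodule.Quotient.mk_eq_zero]
    exact ⟨V w, rfl⟩
  -- This is index zero in finite dimension: `f` is onto and kills the range of `B`, so `dim E/H ≤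
  -- dim W - rank B = dim ker B ≤ dim N`.
  have hdim : Module.finrank ℂ (E ⧸ H) ≤ Module.finrank ℂ N := by
    have e1 := LinearMap.finrank_range_add_finrank_ker f
    have e2 := LinearMap.finrank_range_add_finrank_ker B
    rw [LinearMap.range_eq_top.2 hf, finrank_top] at e1
    have e3 := Submodule.finrank_mono hBf
    omega
  let q : N →ₗ[ℂ] E ⧸ H := H.mkQ.comp N.subtype
  have hq : Function.Injective q := by
    rw [← LinearMap.ker_eq_bot, eq_bot_iff]
    intro x hx
    have hx' : H.mkQ (x : E) = 0 := hx
    rw [Submodule.mkQ_apply, Submodule.Quotient.mk_eq_zero] at hx'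
    exact Subtype.ext (Submodule.disjoint_def.1 hdisj x x.2 hx')
  have hqs : Function.Surjective q :=
    (LinearMap.injective_iff_surjective_of_finrank_eq_finrank
      (le_antisymm (LinearMap.finrank_le_finrank_of_injective hq) hdim)).1 hq
  refine ⟨hdisj, codisjoint_iff_le_sup.2 fun x _ => ?_⟩
  obtain ⟨n, hn⟩ := hqs (H.mkQ x)
  have hn' : H.mkQ (x - n) = 0 := by rw [map_sub, ← hn]; exact sub_self _
  rw [Submodule.mkQ_apply, Submodule.Quotient.mk_eq_zero] at hn'
  exact Submodule.mem_sup.2 ⟨n, n.2, x - n, hn', by abel⟩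

/-- On a closed complement of the kernel the operator is injective with the same range. That range
has a closed algebraic complement, namely the kernel, so the open mapping theorem makes it closed.
-/
theorem isClosed_range_of_isCompl_ker [CompleteSpace E] {A : E →L[ℂ] E}
    [FiniteDimensional ℂ (LinearMap.ker (A : E →ₗ[ℂ] E))]
    (h : IsCompl (LinearMap.ker (A : E →ₗ[ℂ] E)) (LinearMap.range (A : E →ₗ[ℂ] E))) :
    IsClosed (LinearMap.range (A : E →ₗ[ℂ] E) : Set E) := by
  obtain ⟨C, hC, hNC⟩ := (Submodule.ClosedComplemented.of_finiteDimensional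
    (LinearMap.ker (A : E →ₗ[ℂ] E))).exists_isClosed_isCompl
  have : CompleteSpace C := hC.completeSpace_coe
  have hrange : LinearMap.range ((A.comp C.subtypeL : C →L[ℂ] E) : C →ₗ[ℂ] E)
      = LinearMap.range (A : E →ₗ[ℂ] E) := by
    apply le_antisymm
    · rintro _ ⟨x, rfl⟩; exact ⟨x, rfl⟩
    · rintro _ ⟨x, rfl⟩
      obtain ⟨n, hn, c, hc, rfl⟩ := Submodule.mem_sup.1
        (hNC.sup_eq_top ▸ Submodule.mem_top : x ∈ LinearMap.ker (A : E →ₗ[ℂ] E) ⊔ C)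
      refine ⟨⟨c, hc⟩, ?_⟩
      have hn0 : (A : E →ₗ[ℂ] E) n = 0 := hn
      rw [map_add, hn0, zero_add]; rfl
  rw [← hrange]
  refine ContinuousLinearMap.closed_complemented_range_of_isCompl_of_ker_eq_bot _
    (LinearMap.ker (A : E →ₗ[ℂ] E)) (hrange ▸ h.symm) A.isClosed_ker ?_
  rw [eq_bot_iff]
  intro x hx
  exact Subtype.ext (Submodule.disjoint_def.1 hNC.disjoint x hx x.2)

theorem finiteDimensional_range_add {A B : E →ₗ[ℂ] E}
    [FiniteDimensional ℂ (LinearMap.range A)] [FiniteDimensional ℂ (LinearMap.range B)] :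
    FiniteDimensional ℂ (LinearMap.range (A + B)) :=
  Submodule.finiteDimensional_of_le (S₂ := LinearMap.range A ⊔ LinearMap.range B)
    (LinearMap.range_add_le A B)

theorem finiteDimensional_range_mul_left (A B : E →L[ℂ] E)
    [FiniteDimensional ℂ (LinearMap.range (A : E →ₗ[ℂ] E))] :
    FiniteDimensional ℂ (LinearMap.range ((A * B : E →L[ℂ] E) : E →ₗ[ℂ] E)) :=
  Submodule.finiteDimensional_of_le
    (LinearMap.range_comp_le_range (B : E →ₗ[ℂ] E) (A : E →ₗ[ℂ] E))

theorem finiteDimensional_range_mul_right (A B : E →L[ℂ] E)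
    [FiniteDimensional ℂ (LinearMap.range (B : E →ₗ[ℂ] E))] :
    FiniteDimensional ℂ (LinearMap.range ((A * B : E →L[ℂ] E) : E →ₗ[ℂ] E)) := by
  have h : LinearMap.range ((A * B : E →L[ℂ] E) : E →ₗ[ℂ] E)
      = (LinearMap.range (B : E →ₗ[ℂ] E)).map (A : E →ₗ[ℂ] E) :=
    LinearMap.range_comp (B : E →ₗ[ℂ] E) (A : E →ₗ[ℂ] E)
  rw [h]
  infer_instance

/-- A polynomial with roots outside a disc, at a small perturbation of a finite rank operator, is
invertible up to finite rank. -/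
theorem exists_unit_add_finiteRank [CompleteSpace E] {S K R : E →L[ℂ] E} (hS : S = K + R)
    [FiniteDimensional ℂ (LinearMap.range (K : E →ₗ[ℂ] E))] {r : ℝ} (hR : ‖R‖ < r)
    {Q : ℂ[X]} (hQ : Q ∈ outerPolys r) :
    ∃ (U : (E →L[ℂ] E)ˣ) (G : E →L[ℂ] E),
      FiniteDimensional ℂ (LinearMap.range (G : E →ₗ[ℂ] E)) ∧ aeval S Q = U + G := by
  induction hQ using Submonoid.closure_induction with
  | mem A h =>
    obtain ⟨z, hz, rfl⟩ := h
    -- `S - z = -(z - R) + K`, where `z - R` is invertible because `‖R‖ < |z|`.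
    have hu : IsUnit (algebraMap ℂ (E →L[ℂ] E) z - R) := by
      refine spectrum.mem_resolventSet_of_norm_lt_mul (lt_of_le_of_lt ?_ (hR.trans_le hz))
      exact mul_le_of_le_one_right (norm_nonneg _) ContinuousLinearMap.norm_id_le
    obtain ⟨U, hU⟩ := hu
    refine ⟨-U, K, inferInstance, ?_⟩
    rw [Units.val_neg, hU, map_sub, aeval_X, aeval_C, hS]
    abel
  | one =>
    refine ⟨1, 0, ?_, by simp⟩
    rw [ContinuousLinearMap.toLinearMap_zero, LinearMap.range_zero]
    infer_instance
  | mul A B _ _ hA hB =>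
    obtain ⟨U, F, hF, hUF⟩ := hA
    obtain ⟨V, G, hG, hVG⟩ := hB
    refine ⟨U * V, F * aeval S B + U * G, ?_, ?_⟩
    · have h1 := finiteDimensional_range_mul_left F (aeval S B)
      have h2 := finiteDimensional_range_mul_right (U : E →L[ℂ] E) G
      exact finiteDimensional_range_add
    · rw [map_mul, hUF, hVG, Units.val_mul]
      noncomm_ring

theorem isInternal_option_elim {m : ℕ} {H : Submodule ℂ E} {K : Fin m → Submodule ℂ E}
    (hK : iSupIndep K) (hc : IsCompl H (⨆ i, K i)) :
    DirectSum.IsInternal (fun o : Option (Fin m) => o.elim H K) := by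
  refine DirectSum.isInternal_submodule_of_iSupIndep_of_iSup_eq_top ?_ ?_
  · rw [iSupIndep_def]
    rintro (_ | i)
    · refine hc.disjoint.mono_right (iSup₂_le ?_)
      rintro (_ | j) hj
      · exact absurd rfl hj
      · exact le_iSup K j
    · have h1 : Disjoint (K i) (⨆ (j) (_ : j ≠ i), K j) := hK i
      have h2 : Disjoint (K i ⊔ ⨆ (j) (_ : j ≠ i), K j) H :=
        hc.disjoint.symm.mono_left (sup_le (le_iSup K i) (iSup₂_le fun j _ => le_iSup K j))
      refine (h1.disjoint_sup_right_of_disjoint_sup_left h2).mono_right (iSup₂_le ?_)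
      rintro (_ | j) hj
      · exact le_sup_right
      · exact le_sup_of_le_left (le_iSup₂_of_le j (fun h => hj (congrArg some h)) le_rfl)
  · rw [iSup_option_elim]
    exact hc.sup_eq_top

theorem aeval_apply_of_eigenvector {S : E →L[ℂ] E} {w : ℂ} {x : E} (hx : S x = w • x)
    (Q : ℂ[X]) : aeval S Q x = Q.eval w • x := by
  have hpow : ∀ n : ℕ, (S ^ n) x = w ^ n • x := by
    intro n
    induction n with
    | zero => simp
    | succ n ih =>
      rw [pow_succ]
      change (S ^ n) (S x) = _
      rw [hx, map_smul, ih, smul_smul, pow_succ']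
  induction Q using Polynomial.induction_on' with
  | add P Q hP hQ => rw [map_add, eval_add, add_smul, add_apply, hP, hQ]
  | monomial n a =>
    rw [aeval_monomial, eval_monomial, mul_smul, ← hpow]
    simp [Algebra.algebraMap_eq_smul_one]

/-- Makes the kernel and range of a polynomial in `T ^ N` invariant under `T` itself, not only under
`T ^ N`. -/
theorem aeval_pow_apply_comm (T : E →L[ℂ] E) (N : ℕ) (Q : ℂ[X]) (x : E) :
    aeval (T ^ N) Q (T x) = T (aeval (T ^ N) Q x) := by
  have h : aeval (T ^ N) Q = aeval T (Q.comp (X ^ N)) := by rw [aeval_comp]; simp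
  have h1 := aeval_mul_apply T (Q.comp (X ^ N)) X x
  have h2 := aeval_mul_apply' T (Q.comp (X ^ N)) X x
  rw [aeval_X] at h1 h2
  rw [h, ← h1, h2]

/-- Some root `‖S ^ n‖ ^ (1 / n)` is less than `r` if, on a complete space, `S - z` is bijective for all
`z` with `|z| ≥ r`. -/
theorem exists_pow_norm_lt [CompleteSpace E] (S : E →L[ℂ] E) {r : ℝ} (hr : 0 < r)
    (hbij : ∀ z : ℂ, r ≤ ‖z‖ → Function.Bijective fun x => S x - z • x) :
    ∃ n : ℕ, 1 ≤ n ∧ ‖S ^ n‖ ^ (1 / (n : ℝ)) < r := by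
  have hrad : spectralRadius ℂ S < ENNReal.ofReal r := by
    rcases subsingleton_or_nontrivial E with hE | hE
    · have : Subsingleton (E →L[ℂ] E) := ⟨fun f g => by ext x; exact Subsingleton.elim _ _⟩
      rw [spectrum.SpectralRadius.of_subsingleton]
      simpa using hr
    · refine spectrum.spectralRadius_lt_of_forall_lt S (r := r.toNNReal) fun z hz => ?_
      by_contra hcon
      have hz' : r ≤ ‖z‖ := by
        rw [not_lt, Real.toNNReal_le_iff_le_coe] at hcon
        exact hcon
      apply hz
      change IsUnit (algebraMap ℂ (E →L[ℂ] E) z - S)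
      rw [← neg_sub, IsUnit.neg_iff, ContinuousLinearMap.isUnit_iff_bijective]
      convert! hbij z hz' using 2
  have hlim := spectrum.pow_norm_pow_one_div_tendsto_nhds_spectralRadius S
  obtain ⟨n, hn, hn1⟩ := ((hlim.eventually_lt_const hrad).and (eventually_ge_atTop 1)).exists
  exact ⟨n, hn1, (ENNReal.ofReal_lt_ofReal_iff hr).1 hn⟩

end Fredholm

/-! ### From the kernel–range splitting to quasi-compactness -/

section Decomposition

variable {E : Type*} [NormedAddCommGroup E] [NormedSpace ℂ E]

/-- The generalized eigenspaces of an operator inside a finite dimensional invariant subspace that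
contains all those for the eigenvalues occurring there. -/
theorem exists_genEigenspaces_of_invariant (f : Module.End ℂ E) (M : Submodule ℂ E)
    [FiniteDimensional ℂ M] (hM : ∀ x ∈ M, f x ∈ M)
    (hgen : ∀ μ : ℂ, (∃ x ∈ M, x ≠ 0 ∧ f x = μ • x) → ∀ k : ℕ, f.genEigenspace μ k ≤ M)
    (hM0 : ∃ x ∈ M, x ≠ 0) :
    ∃ (m : ℕ) (lam : Fin m → ℂ) (p : ℕ), 1 ≤ m ∧ 1 ≤ p ∧
      (∀ i, ∃ x ∈ M, x ≠ 0 ∧ f x = lam i • x) ∧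
      iSupIndep (fun i => f.genEigenspace (lam i) p) ∧
      (⨆ i, f.genEigenspace (lam i) p) = M := by
  set g : Module.End ℂ M := f.restrict hM with hg
  have hnt : Nontrivial M := by
    obtain ⟨x, hx, hx0⟩ := hM0
    exact ⟨⟨x, hx⟩, 0, fun h => hx0 (congrArg Subtype.val h)⟩
  -- One exponent serves all eigenvalues: inside `M` generalized eigenspaces stabilize by the
  -- dimension of `M`.
  set p := Module.finrank ℂ M with hp
  have : Finite {μ : ℂ // g.HasEigenvalue μ} := Finite.of_fintype g.Eigenvalues
  have := Fintype.ofFinite {μ : ℂ // g.HasEigenvalue μ}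
  let e := Fintype.equivFin {μ : ℂ // g.HasEigenvalue μ}
  have hev : ∀ μ : {μ : ℂ // g.HasEigenvalue μ}, ∃ x ∈ M, x ≠ 0 ∧ f x = (μ : ℂ) • x := by
    intro μ
    obtain ⟨x, hx⟩ := μ.2.exists_hasEigenvector
    exact ⟨x, x.2, fun h => hx.2 (Subtype.ext h), congrArg Subtype.val hx.apply_eq_smul⟩
  have hne : Nonempty {μ : ℂ // g.HasEigenvalue μ} := by
    obtain ⟨μ, hμ⟩ := Module.End.exists_eigenvalue g
    exact ⟨⟨μ, hμ⟩⟩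
  refine ⟨Fintype.card {μ : ℂ // g.HasEigenvalue μ}, fun i => (e.symm i : ℂ), p, Fintype.card_pos,
    Module.finrank_pos, fun i => hev _, ?_, le_antisymm ?_ ?_⟩
  · refine (f.independent_genEigenspace (p : ℕ∞)).comp
      (f := fun i : Fin (Fintype.card {μ : ℂ // g.HasEigenvalue μ}) => (e.symm i : ℂ)) ?_
    exact Subtype.val_injective.comp e.symm.injective
  · exact iSup_le fun i => hgen _ (hev _) p
  · have htop := Module.End.iSup_maxGenEigenspace_eq_top g
    have h1 : M = ⨆ μ : ℂ, (g.maxGenEigenspace μ).map M.subtype := by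
      rw [← Submodule.map_iSup, htop, Submodule.map_top, Submodule.range_subtype]
    nth_rewrite 1 [h1]
    refine iSup_le fun μ => ?_
    by_cases hμ : g.HasEigenvalue μ
    · refine le_trans ?_ (le_iSup (fun i => f.genEigenspace (e.symm i : ℂ)
        (p : ℕ∞)) (e ⟨μ, hμ⟩))
      rw [Equiv.symm_apply_apply, Module.End.maxGenEigenspace_eq_genEigenspace_finrank,
        ← Submodule.inf_genEigenspace]
      exact inf_le_right
    · have : g.maxGenEigenspace μ = ⊥ := by
        rw [Module.End.maxGenEigenspace_eq_genEigenspace_finrank]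
        by_contra hb
        exact hμ (Module.End.hasEigenvalue_of_hasGenEigenvalue (k := p) hb)
      rw [this, Submodule.map_bot]
      exact bot_le

/-- **Quasi-compactness** of an operator, fixing a nonzero vector, one of whose powers is a small
perturbation of a finite rank operator. -/
theorem quasiCompactAt_of_pow_eq_add [CompleteSpace E] {T K R : E →L[ℂ] E} {N : ℕ} (hN : 1 ≤ N)
    (hS : T ^ N = K + R) [FiniteDimensional ℂ (LinearMap.range (K : E →ₗ[ℂ] E))] {r₀ : ℝ}
    (hr₀ : 0 < r₀) (hr₁ : r₀ ≤ 1) (hR : 2 * ‖R‖ < r₀ ^ N) {v : E} (hv : v ≠ 0) (hTv : T v = v) :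
    QuasiCompactAt T r₀ := by
  set S := T ^ N with hSdef
  set r := r₀ ^ N with hr
  have hrpos : 0 < r := pow_pos hr₀ N
  obtain ⟨Q, hQ, hstab⟩ := exists_stable_outerPoly hS hR
  have hRr : ‖R‖ < r := by linarith [norm_nonneg R]
  have hmax : ∀ Q' ∈ outerPolys r, ∀ x, aeval S (Q * Q') x = 0 → aeval S Q x = 0 :=
    fun Q' hQ' => ker_mul_outerPoly_le hstab hQ'
  have hmax' : ∀ Q' ∈ outerPolys r, ∀ x, aeval S Q' x = 0 → aeval S Q x = 0 :=
    fun Q' hQ' x hx => hmax Q' hQ' x (aeval_apply_eq_zero_of_dvd (Dvd.intro_left _ rfl) hx)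
  -- all multiples of `Q` split the space, with the same kernel
  have hsplit : ∀ Q' ∈ outerPolys r,
      FiniteDimensional ℂ (LinearMap.ker (aeval S (Q * Q') : E →ₗ[ℂ] E)) ∧
      IsCompl (LinearMap.ker (aeval S (Q * Q') : E →ₗ[ℂ] E))
        (LinearMap.range (aeval S (Q * Q') : E →ₗ[ℂ] E)) := by
    intro Q' hQ'
    obtain ⟨U, G, hG, hUG⟩ := exists_unit_add_finiteRank hS hRr (mul_mem hQ hQ')
    refine isCompl_ker_range_of_unit_add U hUG fun x hx => ?_
    rw [← aeval_mul_apply] at hx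
    exact aeval_apply_eq_zero_of_dvd (Dvd.intro _ rfl)
      (hmax' _ (mul_mem (mul_mem hQ hQ') (mul_mem hQ hQ')) x hx)
  have hker : ∀ Q' ∈ outerPolys r, LinearMap.ker (aeval S (Q * Q') : E →ₗ[ℂ] E)
      = LinearMap.ker (aeval S Q : E →ₗ[ℂ] E) := fun Q' hQ' => le_antisymm
    (fun x hx => hmax Q' hQ' x hx)
    (fun x hx => aeval_apply_eq_zero_of_dvd (Dvd.intro _ rfl) hx)
  have hsplit1 := hsplit 1 (one_mem _)
  rw [mul_one] at hsplit1
  set A := aeval S Q with hA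
  set M := LinearMap.ker (A : E →ₗ[ℂ] E) with hM
  set H := LinearMap.range (A : E →ₗ[ℂ] E) with hH
  obtain ⟨hMfin, hcompl⟩ := hsplit1
  have hHclosed : IsClosed (H : Set E) := isClosed_range_of_isCompl_ker hcompl
  have hAT : ∀ x, A (T x) = T (A x) := aeval_pow_apply_comm T N Q
  have hMT : ∀ x ∈ M, T x ∈ M := by
    intro x hx
    have hx0 : A x = 0 := hx
    change A (T x) = 0
    rw [hAT, hx0, map_zero]
  have hHT : ∀ x ∈ H, T x ∈ H := by
    rintro _ ⟨y, rfl⟩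
    exact ⟨T y, hAT y⟩
  have hpoweig : ∀ (μ : ℂ) (x : E), T x = μ • x → S x = μ ^ N • x := by
    intro μ x hx
    have := aeval_apply_of_eigenvector hx (X ^ N)
    rwa [map_pow, aeval_X, eval_pow, eval_X] at this
  -- eigenvalues on `M` are large, and large generalized eigenspaces lie in `M`
  have hlarge : ∀ μ : ℂ, (∃ x ∈ M, x ≠ 0 ∧ T x = μ • x) → r₀ ≤ ‖μ‖ := by
    rintro μ ⟨x, hxM, hx0, hx⟩
    have hx1 : A x = 0 := hxM
    rw [hA, aeval_apply_of_eigenvector (hpoweig μ x hx), smul_eq_zero, or_iff_left hx0] at hx1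
    have := norm_root_of_mem_outerPolys hQ hx1
    rw [norm_pow] at this
    exact le_of_pow_le_pow_left₀ (by omega) (norm_nonneg _) this
  have hgen : ∀ μ : ℂ, r₀ ≤ ‖μ‖ → ∀ k : ℕ,
      Module.End.genEigenspace (T : E →ₗ[ℂ] E) μ k ≤ M := by
    intro μ hμ k x hx
    rw [Module.End.mem_genEigenspace_nat, LinearMap.mem_ker] at hx
    -- Since `X - μ` divides `X ^ N - μ ^ N`, a vector killed by `(T - μ) ^ k` is killed by `(S - μ
    -- ^ N) ^ k`, whose root has modulus at least `r`.
    have hmem : (X - C (μ ^ N)) ^ k ∈ outerPolys r :=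
      pow_mem (X_sub_C_mem_outerPolys (by rw [norm_pow]; exact pow_le_pow_left₀ hr₀.le hμ N)) k
    refine hmax' _ hmem x ?_
    have h1 : aeval S ((X - C (μ ^ N)) ^ k) = aeval T ((X ^ N - C μ ^ N) ^ k) := by
      simp [hSdef]
    have h2 : aeval T ((X - C μ) ^ k) x = 0 := by
      rw [← hx, map_pow]
      have : ∀ (k : ℕ) (y : E), ((aeval T (X - C μ)) ^ k) y
          = (((T : E →ₗ[ℂ] E) - μ • (1 : Module.End ℂ E)) ^ k) y := by
        intro k
        induction k with
        | zero => intro y; rfl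
        | succ k ih =>
          intro y
          rw [pow_succ, pow_succ]
          change ((aeval T (X - C μ)) ^ k) (aeval T (X - C μ) y) = _
          rw [ih, aeval_X_sub_C_apply]
          rfl
      exact this k x
    rw [h1]
    exact aeval_apply_eq_zero_of_dvd (pow_dvd_pow_of_dvd (sub_dvd_pow_sub_pow X (C μ) N) k) h2
  -- The fixed vector shows `M ≠ 0`, so that at least one eigenvalue occurs.
  have hvM : v ∈ M := by
    have h1 : v ∈ Module.End.genEigenspace (T : E →ₗ[ℂ] E) 1 (1 : ℕ) := by
      rw [Module.End.mem_genEigenspace_nat, LinearMap.mem_ker, pow_one]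
      change T v - (1 : ℂ) • v = 0
      rw [hTv, one_smul, sub_self]
    exact hgen 1 (by simpa using hr₁) 1 h1
  obtain ⟨m, lam, p, hm, hp, hlam, hind, hsup⟩ :=
    exists_genEigenspaces_of_invariant (T : E →ₗ[ℂ] E) M hMT
      (fun μ hμ => hgen μ (hlarge μ hμ)) ⟨v, hvM, hv⟩
  have hK : ∀ i, Module.End.genEigenspace (T : E →ₗ[ℂ] E) (lam i) p
      = LinearMap.ker (((T : E →ₗ[ℂ] E) - lam i • (LinearMap.id : E →ₗ[ℂ] E)) ^ p) := fun i =>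
    Module.End.genEigenspace_nat
  simp only [hK] at hind hsup
  have hfin : ∀ i, FiniteDimensional ℂ
      (LinearMap.ker (((T : E →ₗ[ℂ] E) - lam i • (LinearMap.id : E →ₗ[ℂ] E)) ^ p)) := fun i =>
    Submodule.finiteDimensional_of_le (S₂ := M) ((le_iSup (fun i => LinearMap.ker
      (((T : E →ₗ[ℂ] E) - lam i • (LinearMap.id : E →ₗ[ℂ] E)) ^ p)) i).trans hsup.le)
  refine ⟨m, lam, fun _ => p, H, hm, fun _ => hp,
    isInternal_option_elim hind (by rw [hsup]; exact hcompl.symm),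
    fun i => ⟨hlarge _ (hlam i), hfin i, ?_⟩, hHclosed, hHT, ?_⟩
  · obtain ⟨x, -, hx0, hx⟩ := hlam i
    have hxk : x ∈ LinearMap.ker
        (((T : E →ₗ[ℂ] E) - lam i • (LinearMap.id : E →ₗ[ℂ] E)) ^ p) := by
      obtain ⟨q, rfl⟩ := Nat.exists_eq_add_of_le' hp
      rw [LinearMap.mem_ker, pow_succ, Module.End.mul_apply]
      have : ((T : E →ₗ[ℂ] E) - lam i • (LinearMap.id : E →ₗ[ℂ] E)) x = 0 := by
        change T x - lam i • x = 0
        exact sub_eq_zero.2 hx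
      rw [this, map_zero]
    have := hfin i
    exact Module.finrank_pos_iff_exists_ne_zero.2 ⟨⟨x, hxk⟩, fun h => hx0 (congrArg Subtype.val h)⟩
  · have : CompleteSpace H := hHclosed.completeSpace_coe
    let TH : H →L[ℂ] H := T.restrict hHT
    have hTH : ∀ (n : ℕ) (x : H), ((TH ^ n) x : E) = (T ^ n) (x : E) := by
      intro n
      induction n with
      | zero => intro x; rfl
      | succ n ih =>
        intro x
        rw [pow_succ, pow_succ]
        change ((TH ^ n) (TH x) : E) = (T ^ n) (T x)
        rw [ih]; rfl
    obtain ⟨n, hn, hlt⟩ := exists_pow_norm_lt (TH ^ N) hrpos (by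
      intro z hz
      have hXz := X_sub_C_mem_outerPolys hz
      constructor
      -- A vector of `H` killed by `S - z` lies in `M` by maximality of `Q`, hence in `M ∩ H = 0`.
      · intro x y hxy
        have hxy' : S ((x - y : H) : E) - z • ((x - y : H) : E) = 0 := by
          have : ((TH ^ N) x - z • x : H) = (TH ^ N) y - z • y := hxy
          have h2 := congrArg Subtype.val this
          simp only [AddSubgroupClass.coe_sub, SetLike.val_smul, hTH] at h2
          rw [AddSubgroupClass.coe_sub, map_sub, smul_sub, hSdef]
          rw [← sub_eq_zero] at h2
          rw [← h2]; abel
        rw [← aeval_X_sub_C_apply] at hxy'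
        have hmemM : ((x - y : H) : E) ∈ M := hmax' _ hXz _ hxy'
        have := Submodule.disjoint_def.1 hcompl.disjoint _ hmemM (x - y).2
        exact sub_eq_zero.1 (Subtype.ext this)
      · intro y
        -- The range of `Q(S)(S - z)` lies in `H` and has the same complement `M`; by modularity it
        -- equals `H`, so `S - z` maps `H` onto `H`.
        have hc := (hsplit _ hXz).2
        rw [hker _ hXz] at hc
        have hle : LinearMap.range (aeval S (Q * (X - C z)) : E →ₗ[ℂ] E) ≤ H := by
          rintro _ ⟨x, rfl⟩
          exact ⟨aeval S (X - C z) x, (aeval_mul_apply S _ _ x).symm⟩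
        have heq : LinearMap.range (aeval S (Q * (X - C z)) : E →ₗ[ℂ] E) = H :=
          eq_of_le_of_inf_le_of_sup_le (z := M) hle
            (by rw [hcompl.symm.disjoint.eq_bot]; exact bot_le)
            (by rw [sup_comm, hcompl.sup_eq_top, sup_comm, hc.sup_eq_top])
        obtain ⟨x, hx⟩ := (heq.symm ▸ y.2 :
          (y : E) ∈ LinearMap.range (aeval S (Q * (X - C z)) : E →ₗ[ℂ] E))
        refine ⟨⟨A x, x, rfl⟩, Subtype.ext ?_⟩
        rw [← hx]
        change (((TH ^ N) ⟨A x, x, rfl⟩ : H) : E) - z • A x = aeval S (Q * (X - C z)) x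
        rw [hTH, aeval_mul_apply', aeval_X_sub_C_apply])
    have hNn : 0 < N * n := Nat.mul_pos hN hn
    refine lt_of_le_of_lt (ciInf_le ⟨0, by rintro _ ⟨k, rfl⟩; positivity⟩ ⟨N * n, hNn⟩) ?_
    have hle : ‖(T ^ (N * n)).comp H.subtypeL‖ ≤ ‖(TH ^ N) ^ n‖ := by
      refine ContinuousLinearMap.opNorm_le_bound _ (ContinuousLinearMap.opNorm_nonneg _) fun x => ?_
      change ‖(T ^ (N * n)) (x : E)‖ ≤ _
      rw [← hTH, pow_mul]
      exact ((TH ^ N) ^ n).le_opNorm x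
    have hNn' : (1 / ((N * n : ℕ) : ℝ)) = 1 / (n : ℝ) * (1 / (N : ℝ)) := by
      push_cast; ring
    change ‖(T ^ (N * n)).comp H.subtypeL‖ ^ (1 / ((N * n : ℕ) : ℝ)) < r₀
    calc ‖(T ^ (N * n)).comp H.subtypeL‖ ^ (1 / ((N * n : ℕ) : ℝ))
        ≤ ‖(TH ^ N) ^ n‖ ^ (1 / ((N * n : ℕ) : ℝ)) :=
          Real.rpow_le_rpow (ContinuousLinearMap.opNorm_nonneg _) hle (by positivity)
      _ = (‖(TH ^ N) ^ n‖ ^ (1 / (n : ℝ))) ^ (1 / (N : ℝ)) := by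
          rw [hNn', Real.rpow_mul (ContinuousLinearMap.opNorm_nonneg _)]
      _ < r ^ (1 / (N : ℝ)) :=
          Real.rpow_lt_rpow (by positivity) hlt (by
            have : (0 : ℝ) < N := by exact_mod_cast hN
            positivity)
      _ = r₀ := by
          rw [hr, one_div, Real.pow_rpow_inv_natCast hr₀.le (by omega)]

/-- The complement in a decomposition at level `r₀` has finite codimension. -/
theorem exists_finite_codim_of_quasiCompactAt {T : E →L[ℂ] E} {r₀ : ℝ}
    (h : QuasiCompactAt T r₀) :
    ∃ H : Submodule ℂ E, FiniteDimensional ℂ (E ⧸ H) ∧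
      (⨅ n : ℕ+, ‖(T ^ (n : ℕ)).comp H.subtypeL‖ ^ (1 / ((n : ℕ) : ℝ))) < r₀ := by
  obtain ⟨m, lam, p, H, -, -, hint, hlam, -, -, hlt⟩ := h
  refine ⟨H, ?_, hlt⟩
  have htop := hint.submodule_iSup_eq_top
  rw [iSup_option_elim] at htop
  set K : Fin m → Submodule ℂ E := fun i =>
    LinearMap.ker (((T : E →ₗ[ℂ] E) - lam i • (LinearMap.id : E →ₗ[ℂ] E)) ^ p i) with hK
  have : ∀ i, FiniteDimensional ℂ (K i) := fun i => (hlam i).2.1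
  refine Module.Finite.of_surjective (H.mkQ.comp (⨆ i, K i).subtype) fun q => ?_
  obtain ⟨x, rfl⟩ := H.mkQ_surjective q
  obtain ⟨h, hh, k, hk, rfl⟩ := Submodule.mem_sup.1 (htop ▸ Submodule.mem_top : x ∈ H ⊔ ⨆ i, K i)
  refine ⟨⟨k, hk⟩, ?_⟩
  change H.mkQ k = _
  have hh0 : H.mkQ h = 0 := (Submodule.Quotient.mk_eq_zero H).2 hh
  rw [map_add, hh0, zero_add]

end Decomposition

/-! ### Completeness of `B_V` and finite rank truncations -/

namespace BSpace

variable {V : Weight}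

theorem norm_apply_le (f : BSpace V) (n : ℕ) : ‖f n‖ ≤ ‖f‖ * V n :=
  (div_le_iff₀ (V.pos n)).1 (le_norm f n)

theorem norm_le_of_forall {f : BSpace V} {C : ℝ} (h : ∀ n, ‖f n‖ ≤ C * V n) : ‖f‖ ≤ C :=
  ciSup_le fun n => (div_le_iff₀ (V.pos n)).2 (h n)

/-- The element of `B_V` given by a function bounded by a multiple of `V`. -/
def ofBound (f : ℕ → ℂ) (C : ℝ) (h : ∀ n, ‖f n‖ ≤ C * V n) : BSpace V :=
  ⟨f, C, by rintro _ ⟨n, rfl⟩; exact (div_le_iff₀ (V.pos n)).2 (h n)⟩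

theorem ext' {f g : BSpace V} (h : ∀ n, f n = g n) : f = g := Subtype.ext (funext h)

/-- Division by the weight, as an additive map onto the bounded functions. -/
noncomputable def toBounded : BSpace V →+ BoundedContinuousFunction ℕ ℂ where
  toFun f := BoundedContinuousFunction.ofNormedAddCommGroupDiscrete (fun n => f n / (V n : ℂ)) ‖f‖
    fun n => by
      rw [norm_div, Complex.norm_real, Real.norm_of_nonneg (V.pos n).le]
      exact le_norm f n
  map_zero' := by ext n; exact zero_div _
  map_add' f g := by ext n; exact add_div _ _ _

theorem toBounded_apply (f : BSpace V) (n : ℕ) : toBounded f n = f n / (V n : ℂ) := rfl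

theorem isometry_toBounded : Isometry (toBounded (V := V)) := by
  refine AddMonoidHomClass.isometry_of_norm _ fun f => ?_
  rw [BoundedContinuousFunction.norm_eq_iSup_norm, norm_def]
  refine iSup_congr fun n => ?_
  rw [toBounded_apply, norm_div, Complex.norm_real, Real.norm_of_nonneg (V.pos n).le]

theorem surjective_toBounded : Function.Surjective (toBounded (V := V)) := by
  intro g
  refine ⟨ofBound (fun n => g n * (V n : ℂ)) ‖g‖ fun n => ?_, ?_⟩
  · rw [norm_mul, Complex.norm_real, Real.norm_of_nonneg (V.pos n).le]
    exact mul_le_mul_of_nonneg_right (g.norm_coe_le_norm n) (V.pos n).le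
  · ext n
    have : (V n : ℂ) ≠ 0 := Complex.ofReal_ne_zero.2 (V.pos n).ne'
    change g n * (V n : ℂ) / (V n : ℂ) = g n
    field_simp

instance : CompleteSpace (BSpace V) :=
  (isometry_toBounded.isUniformInducing.completeSpace_congr surjective_toBounded).2 inferInstance

theorem norm_map_le_of_forall {T : BSpace V →L[ℂ] BSpace V} {C : ℝ} (hC : 0 ≤ C)
    (h : ∀ f n, ‖T f n‖ ≤ ‖f‖ * (C * V n)) : ‖T‖ ≤ C :=
  T.opNorm_le_bound hC fun f => norm_le_of_forall fun n => (h f n).trans_eq (by ring)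

/-- Restriction of functions to `{0, …, m - 1}`. -/
noncomputable def truncation (V : Weight) (m : ℕ) : BSpace V →L[ℂ] BSpace V :=
  LinearMap.mkContinuous
    { toFun := fun f => ofBound (fun n => if n < m then f n else 0) ‖f‖ (fun n => by
        split_ifs
        · exact norm_apply_le f n
        · rw [norm_zero]; exact mul_nonneg (norm_nonneg _) (V.pos n).le)
      map_add' := fun f g => ext' fun n => by
        change (if n < m then f n + g n else 0) = (if n < m then f n else 0) + if n < m then g n else 0
        split_ifs <;> simp
      map_smul' := fun z f => ext' fun n => by
        change (if n < m then z * f n else 0) = z * if n < m then f n else 0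
        split_ifs <;> simp }
    1 (fun f => by
      refine norm_le_of_forall fun n => ?_
      rw [one_mul]
      change ‖if n < m then f n else 0‖ ≤ _
      split_ifs
      · exact norm_apply_le f n
      · rw [norm_zero]; exact mul_nonneg (norm_nonneg _) (V.pos n).le)

theorem truncation_apply (m : ℕ) (f : BSpace V) (n : ℕ) :
    truncation V m f n = if n < m then f n else 0 := rfl

instance finiteDimensional_range_truncation (m : ℕ) :
    FiniteDimensional ℂ (LinearMap.range (truncation V m : BSpace V →ₗ[ℂ] BSpace V)) := by
  let e : LinearMap.range (truncation V m : BSpace V →ₗ[ℂ] BSpace V) →ₗ[ℂ] (Fin m → ℂ) :=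
    { toFun := fun f i => (f : BSpace V) i
      map_add' := fun _ _ => rfl
      map_smul' := fun _ _ => rfl }
  refine FiniteDimensional.of_injective e ?_
  rintro ⟨_, f, rfl⟩ ⟨_, g, rfl⟩ h
  refine Subtype.ext (ext' fun n => ?_)
  by_cases hn : n < m
  · exact congrFun h ⟨n, hn⟩
  · change truncation V m f n = truncation V m g n
    rw [truncation_apply, truncation_apply, if_neg hn, if_neg hn]

end BSpace

/-! ### Kernels of bounded range -/

section Band

variable {P : ℕ → ℕ → ℝ} {B : ℕ}

theorem sum_band_eq_one (hP : IsMarkov P) (hB : ∀ i j, i + B < j → P i j = 0) (i : ℕ) :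
    ∑ j ∈ Finset.range (i + B + 1), P i j = 1 := by
  refine (hasSum_sum_of_ne_finset_zero fun j hj => hB i j ?_).unique (hP.hasSum_one i)
  rw [Finset.mem_range] at hj
  omega

/-- The iterates `P ^ n V_γ`, as real functions, for a kernel with `P i j = 0` if `j > i + B`. -/
noncomputable def bandIter (P : ℕ → ℕ → ℝ) (B : ℕ) (γ : ℝ) : ℕ → ℕ → ℝ
  | 0, i => γ ^ i
  | n + 1, i => ∑ j ∈ Finset.range (i + B + 1), P i j * bandIter P B γ n j

theorem bandIter_nonneg (hP : IsMarkov P) {γ : ℝ} (hγ : 1 < γ) (n i : ℕ) :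
    0 ≤ bandIter P B γ n i := by
  induction n generalizing i with
  | zero => exact pow_nonneg (by linarith) i
  | succ n ih => exact Finset.sum_nonneg fun j _ => mul_nonneg (hP.nonneg i j) (ih j)

theorem powAct_eq_bandIter (hP : IsMarkov P) (hB : ∀ i j, i + B < j → P i j = 0) {γ : ℝ}
    (hγ : 1 < γ) (n i : ℕ) :
    powAct P (geomWeight γ hγ) n i = ENNReal.ofReal (bandIter P B γ n i) := by
  induction n generalizing i with
  | zero => rfl
  | succ n ih =>
    rw [powAct, Function.iterate_succ_apply']
    change ∑' j, ENNReal.ofReal (P i j) * powAct P (geomWeight γ hγ) n j = _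
    rw [tsum_eq_sum (s := Finset.range (i + B + 1)), bandIter,
      ENNReal.ofReal_sum_of_nonneg fun j _ =>
        mul_nonneg (hP.nonneg i j) (bandIter_nonneg hP hγ n j)]
    · refine Finset.sum_congr rfl fun j _ => ?_
      rw [ih, ENNReal.ofReal_mul (hP.nonneg i j)]
    · intro j hj
      rw [Finset.mem_range] at hj
      rw [hB i j (by omega), ENNReal.ofReal_zero, zero_mul]

theorem norm_bandSum_le (hP : IsMarkov P) {f : ℕ → ℂ} {u : ℕ → ℝ} {C : ℝ}
    (h : ∀ j, ‖f j‖ ≤ C * u j) (i : ℕ) :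
    ‖∑ j ∈ Finset.range (i + B + 1), (P i j : ℂ) * f j‖
      ≤ C * ∑ j ∈ Finset.range (i + B + 1), P i j * u j := by
  rw [Finset.mul_sum]
  refine norm_sum_le_of_le _ fun j _ => ?_
  rw [norm_mul, Complex.norm_real, Real.norm_of_nonneg (hP.nonneg i j), mul_left_comm]
  exact mul_le_mul_of_nonneg_left (h j) (hP.nonneg i j)

theorem bandIter_one_le (hP : IsMarkov P) (hB : ∀ i j, i + B < j → P i j = 0) {γ : ℝ}
    (hγ : 1 < γ) (i : ℕ) : bandIter P B γ 1 i ≤ γ ^ B * γ ^ i := by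
  calc bandIter P B γ 1 i = ∑ j ∈ Finset.range (i + B + 1), P i j * γ ^ j := rfl
    _ ≤ ∑ j ∈ Finset.range (i + B + 1), P i j * (γ ^ B * γ ^ i) := by
        refine Finset.sum_le_sum fun j hj => mul_le_mul_of_nonneg_left ?_ (hP.nonneg i j)
        rw [← pow_add]
        rw [Finset.mem_range] at hj
        exact pow_le_pow_right₀ hγ.le (by omega)
    _ = γ ^ B * γ ^ i := by rw [← Finset.sum_mul, sum_band_eq_one hP hB, one_mul]

/-- The operator on `B_γ` induced by a kernel with `P i j = 0` if `j > i + B`. -/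
noncomputable def bandOp (hP : IsMarkov P) (hB : ∀ i j, i + B < j → P i j = 0) {γ : ℝ}
    (hγ : 1 < γ) : BSpace (geomWeight γ hγ) →L[ℂ] BSpace (geomWeight γ hγ) :=
  have key : ∀ (f : BSpace (geomWeight γ hγ)) (i : ℕ),
      ‖∑ j ∈ Finset.range (i + B + 1), (P i j : ℂ) * f j‖
        ≤ γ ^ B * ‖f‖ * geomWeight γ hγ i := fun f i =>
    calc ‖∑ j ∈ Finset.range (i + B + 1), (P i j : ℂ) * f j‖
        ≤ ‖f‖ * bandIter P B γ 1 i := norm_bandSum_le hP (BSpace.norm_apply_le f) i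
      _ ≤ ‖f‖ * (γ ^ B * γ ^ i) :=
          mul_le_mul_of_nonneg_left (bandIter_one_le hP hB hγ i) (norm_nonneg f)
      _ = γ ^ B * ‖f‖ * geomWeight γ hγ i := by
          change _ = γ ^ B * ‖f‖ * γ ^ i
          ring
  LinearMap.mkContinuous
    { toFun := fun f => BSpace.ofBound _ _ (key f)
      map_add' := fun f g => BSpace.ext' fun i => by
        change ∑ j ∈ Finset.range (i + B + 1), (P i j : ℂ) * (f j + g j)
          = ∑ j ∈ Finset.range (i + B + 1), (P i j : ℂ) * f j
            + ∑ j ∈ Finset.range (i + B + 1), (P i j : ℂ) * g j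
        rw [← Finset.sum_add_distrib]
        exact Finset.sum_congr rfl fun j _ => mul_add _ _ _
      map_smul' := fun z f => BSpace.ext' fun i => by
        change ∑ j ∈ Finset.range (i + B + 1), (P i j : ℂ) * (z * f j)
          = z * ∑ j ∈ Finset.range (i + B + 1), (P i j : ℂ) * f j
        rw [Finset.mul_sum]
        exact Finset.sum_congr rfl fun j _ => mul_left_comm _ _ _ }
    (γ ^ B) (fun f => BSpace.norm_le_of_forall (key f))

variable (hP : IsMarkov P) (hB : ∀ i j, i + B < j → P i j = 0) {γ : ℝ} (hγ : 1 < γ)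

theorem bandOp_apply (f : BSpace (geomWeight γ hγ)) (i : ℕ) :
    bandOp hP hB hγ f i = ∑ j ∈ Finset.range (i + B + 1), (P i j : ℂ) * f j := rfl

theorem isActionOf_bandOp : IsActionOf P (bandOp hP hB hγ) := by
  intro f i
  rw [bandOp_apply]
  refine hasSum_sum_of_ne_finset_zero fun j hj => ?_
  rw [Finset.mem_range] at hj
  rw [hB i j (by omega), Complex.ofReal_zero, zero_mul]

theorem bandOp_pow_succ_apply (n : ℕ) (f : BSpace (geomWeight γ hγ)) (i : ℕ) :
    (bandOp hP hB hγ ^ (n + 1)) f i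
      = ∑ j ∈ Finset.range (i + B + 1), (P i j : ℂ) * (bandOp hP hB hγ ^ n) f j := by
  rw [pow_succ']
  rfl

/-- Positivity of the kernel reduces operator bounds to the single function `V`. -/
theorem norm_bandOp_pow_apply_le (n : ℕ) (f : BSpace (geomWeight γ hγ)) (i : ℕ) :
    ‖(bandOp hP hB hγ ^ n) f i‖ ≤ ‖f‖ * bandIter P B γ n i := by
  induction n generalizing i with
  | zero => exact BSpace.norm_apply_le f i
  | succ n ih =>
    rw [bandOp_pow_succ_apply]
    exact norm_bandSum_le hP ih i

theorem norm_bandOp_pow_le {n : ℕ} {C : ℝ} (hC : 0 ≤ C)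
    (h : ∀ i, bandIter P B γ n i ≤ C * γ ^ i) : ‖bandOp hP hB hγ ^ n‖ ≤ C :=
  BSpace.norm_map_le_of_forall hC fun f i => (norm_bandOp_pow_apply_le hP hB hγ n f i).trans
    (mul_le_mul_of_nonneg_left (h i) (norm_nonneg f))

/-- Finite propagation: the value of `P ^ n f` at `i` depends on `f` near `i` only. -/
theorem bandOp_pow_apply_of_local {g : ℕ} (hg : ∀ i j, g ≤ i → j + g < i → P i j = 0) (z : ℂ)
    (f : BSpace (geomWeight γ hγ)) (n i : ℕ) (hi : n * g ≤ i)
    (hf : ∀ x, i ≤ x + n * g → x ≤ i + n * B → f x = z * ((γ ^ x : ℝ) : ℂ)) :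
    (bandOp hP hB hγ ^ n) f i = z * (bandIter P B γ n i : ℂ) := by
  induction n generalizing i with
  | zero => exact hf i (by omega) (by omega)
  | succ n ih =>
    rw [bandOp_pow_succ_apply, bandIter, Complex.ofReal_sum, Finset.mul_sum]
    rw [Nat.succ_mul] at hi
    refine Finset.sum_congr rfl fun j hj => ?_
    rw [Finset.mem_range] at hj
    by_cases hj' : j + g < i
    · rw [hg i j (by omega) hj']; simp
    · rw [ih j (by omega) fun x h1 h2 =>
        hf x (by rw [Nat.succ_mul]; omega) (by rw [Nat.succ_mul]; omega)]
      push_cast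
      ring

/-- Iterating the one-step drift inequality, with `P 1 = 1`, gives `P ^ n V ≤ δ ^ n V + b / (1 -
δ)`, and constants are dominated by `V ≥ 1`. -/
theorem powerBounded_bandOp {δ b : ℝ} (hδ0 : 0 ≤ δ) (hδ1 : δ < 1) (hb : 0 ≤ b)
    (h : ∀ i, bandIter P B γ 1 i ≤ δ * γ ^ i + b) : PowerBounded (bandOp hP hB hγ) := by
  have hγp : ∀ i : ℕ, 1 ≤ γ ^ i := fun i => one_le_pow₀ hγ.le
  have key : ∀ n i, bandIter P B γ n i ≤ δ ^ n * γ ^ i + b * ∑ k ∈ Finset.range n, δ ^ k := by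
    intro n
    induction n with
    | zero => intro i; simp [bandIter]
    | succ n ih =>
      intro i
      calc bandIter P B γ (n + 1) i
          ≤ ∑ j ∈ Finset.range (i + B + 1),
              P i j * (δ ^ n * γ ^ j + b * ∑ k ∈ Finset.range n, δ ^ k) :=
            Finset.sum_le_sum fun j _ => mul_le_mul_of_nonneg_left (ih j) (hP.nonneg i j)
        _ = δ ^ n * bandIter P B γ 1 i + b * ∑ k ∈ Finset.range n, δ ^ k := by
            simp_rw [mul_add]
            rw [Finset.sum_add_distrib, ← Finset.sum_mul, sum_band_eq_one hP hB, one_mul]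
            congr 1
            change _ = δ ^ n * ∑ j ∈ Finset.range (i + B + 1), P i j * γ ^ j
            rw [Finset.mul_sum]
            exact Finset.sum_congr rfl fun j _ => mul_left_comm _ _ _
        _ ≤ δ ^ n * (δ * γ ^ i + b) + b * ∑ k ∈ Finset.range n, δ ^ k := by
            have := mul_le_mul_of_nonneg_left (h i) (pow_nonneg hδ0 n)
            linarith
        _ = δ ^ (n + 1) * γ ^ i + b * ∑ k ∈ Finset.range (n + 1), δ ^ k := by
            rw [Finset.sum_range_succ]; ring
  have h1δ : 0 < 1 - δ := by linarith
  refine ⟨1 + b * (1 - δ)⁻¹, fun n _ => norm_bandOp_pow_le hP hB hγ (by positivity) fun i => ?_⟩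
  have hgeom : ∑ k ∈ Finset.range n, δ ^ k ≤ (1 - δ)⁻¹ :=
    (summable_geometric_of_lt_one hδ0 hδ1).sum_le_tsum _ (fun k _ => pow_nonneg hδ0 k)
      |>.trans_eq (tsum_geometric_of_lt_one hδ0 hδ1)
  have h2 : δ ^ n * γ ^ i ≤ 1 * γ ^ i :=
    mul_le_mul_of_nonneg_right (pow_le_one₀ hδ0 hδ1.le) (by linarith [hγp i])
  have h3 : b * ∑ k ∈ Finset.range n, δ ^ k ≤ b * (1 - δ)⁻¹ * γ ^ i :=
    (mul_le_mul_of_nonneg_left hgeom hb).trans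
      (le_mul_of_one_le_right (by positivity) (hγp i))
  linarith [key n i]

/-- An upper bound for the ratios `P ^ N V / V` at infinity bounds the essential spectrum. -/
theorem quasiCompactAt_bandOp {N : ℕ} (hN : 1 ≤ N) {r₀ ρ : ℝ} (hr₀ : 0 < r₀) (hr₁ : r₀ ≤ 1)
    (hρ0 : 0 ≤ ρ) (hρ : 2 * ρ < r₀ ^ N) (h : ∀ᶠ i in atTop, bandIter P B γ N i ≤ ρ * γ ^ i) :
    QuasiCompactAt (bandOp hP hB hγ) r₀ := by
  obtain ⟨m, hm⟩ := eventually_atTop.1 h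
  set T := bandOp hP hB hγ with hT
  -- Only states `i ≥ m` contribute to `T ^ N - K`, and there the ratio is at most `ρ`.
  set K := BSpace.truncation (geomWeight γ hγ) m * T ^ N with hK
  have hKfin := finiteDimensional_range_mul_left (BSpace.truncation (geomWeight γ hγ) m) (T ^ N)
  have hR : ‖T ^ N - K‖ ≤ ρ := by
    refine BSpace.norm_map_le_of_forall hρ0 fun f i => ?_
    change ‖(T ^ N) f i - (if i < m then (T ^ N) f i else 0)‖ ≤ ‖f‖ * (ρ * γ ^ i)
    split_ifs with hi
    · rw [sub_self, norm_zero]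
      exact mul_nonneg (norm_nonneg f) (mul_nonneg hρ0 (pow_nonneg (by linarith) i))
    · rw [sub_zero]
      exact (norm_bandOp_pow_apply_le hP hB hγ N f i).trans
        (mul_le_mul_of_nonneg_left (hm i (not_lt.1 hi)) (norm_nonneg f))
  let v : BSpace (geomWeight γ hγ) := BSpace.ofBound (fun _ => 1) 1 fun n => by
    rw [norm_one, one_mul]; exact (geomWeight γ hγ).one_le n
  have hv : v ≠ 0 := fun h0 => one_ne_zero (congrArg (fun f : BSpace (geomWeight γ hγ) => f 0) h0)
  have hTv : T v = v := BSpace.ext' fun i => by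
    change ∑ j ∈ Finset.range (i + B + 1), (P i j : ℂ) * 1 = 1
    simp_rw [mul_one]
    rw [← Complex.ofReal_sum, sum_band_eq_one hP hB, Complex.ofReal_one]
  exact quasiCompactAt_of_pow_eq_add hN (add_sub_cancel K (T ^ N)).symm hr₀ hr₁
    (by linarith) hv hTv

/-- Functions that are multiples of the weight on successive blocks of length `L`. -/
noncomputable def blockMap (L J k : ℕ) : (Fin (k + 1) → ℂ) →ₗ[ℂ] BSpace (geomWeight γ hγ) where
  toFun c := BSpace.ofBound
    -- Truncated subtraction enlarges the block of index `0` to all `x < (J + 1) * L`. This is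
    -- harmless: the norm bound is unaffected, and values are only used for `x / L ≥ J`.
    (fun x => (if h : x / L - J < k + 1 then c ⟨x / L - J, h⟩ else 0) * ((γ ^ x : ℝ) : ℂ)) ‖c‖
    (fun x => by
      rw [norm_mul, Complex.norm_real, Real.norm_of_nonneg (pow_nonneg (by linarith) x)]
      refine mul_le_mul_of_nonneg_right ?_ (pow_nonneg (by linarith) x)
      split_ifs
      · exact norm_le_pi_norm c _
      · rw [norm_zero]; exact norm_nonneg c)
  map_add' c c' := BSpace.ext' fun x => by
    change (if h : x / L - J < k + 1 then c ⟨x / L - J, h⟩ + c' ⟨x / L - J, h⟩ else 0)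
        * ((γ ^ x : ℝ) : ℂ)
      = (if h : x / L - J < k + 1 then c ⟨x / L - J, h⟩ else 0) * ((γ ^ x : ℝ) : ℂ)
        + (if h : x / L - J < k + 1 then c' ⟨x / L - J, h⟩ else 0) * ((γ ^ x : ℝ) : ℂ)
    split_ifs <;> ring
  map_smul' z c := BSpace.ext' fun x => by
    change (if h : x / L - J < k + 1 then z * c ⟨x / L - J, h⟩ else 0) * ((γ ^ x : ℝ) : ℂ)
      = z * ((if h : x / L - J < k + 1 then c ⟨x / L - J, h⟩ else 0) * ((γ ^ x : ℝ) : ℂ))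
    split_ifs <;> ring

theorem blockMap_apply (L J k : ℕ) (c : Fin (k + 1) → ℂ) (x : ℕ) :
    blockMap hγ L J k c x
      = (if h : x / L - J < k + 1 then c ⟨x / L - J, h⟩ else 0) * ((γ ^ x : ℝ) : ℂ) := rfl

theorem norm_blockMap_le (L J k : ℕ) (c : Fin (k + 1) → ℂ) : ‖blockMap hγ L J k c‖ ≤ ‖c‖ := by
  refine BSpace.norm_le_of_forall fun x => ?_
  rw [blockMap_apply, norm_mul, Complex.norm_real,
    Real.norm_of_nonneg (pow_nonneg (by linarith) x)]
  refine mul_le_mul_of_nonneg_right ?_ (pow_nonneg (by linarith) x)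
  split_ifs
  · exact norm_le_pi_norm c _
  · rw [norm_zero]; exact norm_nonneg c

/-- On a subspace of finite codimension, the norm of `P ^ n` is at least the limit of
`P ^ n V / V`. -/
theorem le_norm_bandOp_pow_comp {g : ℕ} (hg : ∀ i j, g ≤ i → j + g < i → P i j = 0)
    (H : Submodule ℂ (BSpace (geomWeight γ hγ)))
    [FiniteDimensional ℂ (BSpace (geomWeight γ hγ) ⧸ H)] {n : ℕ} {ℓ : ℝ}
    (hlim : Tendsto (fun i => bandIter P B γ n i / γ ^ i) atTop (𝓝 ℓ)) :
    ℓ ≤ ‖(bandOp hP hB hγ ^ n).comp H.subtypeL‖ := by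
  set T := bandOp hP hB hγ with hT
  refine le_of_tendsto_of_frequently hlim (frequently_atTop.2 fun J => ?_)
  set k := Module.finrank ℂ (BSpace (geomWeight γ hγ) ⧸ H) with hk
  set L := n * (g + B) + 1 with hL
  -- There are `k + 1` blocks against codimension `k`.
  have hker : LinearMap.ker (H.mkQ.comp (blockMap hγ L J k)) ≠ ⊥ :=
    LinearMap.ker_ne_bot_of_finrank_lt (by simp [← hk])
  obtain ⟨c, hc, hc0⟩ := Submodule.exists_mem_ne_zero_of_ne_bot hker
  set h := blockMap hγ L J k c with hh
  have hH : h ∈ H := (Submodule.Quotient.mk_eq_zero H).1 hc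
  -- The block with the largest coefficient is tested, because there `‖h‖ ≤ ‖c t‖`.
  obtain ⟨t, ht⟩ := Finite.exists_max fun t => ‖c t‖
  have hct : ‖c‖ = ‖c t‖ :=
    le_antisymm ((pi_norm_le_iff_of_nonneg (norm_nonneg _)).2 ht) (norm_le_pi_norm c t)
  have hcpos : 0 < ‖c t‖ := hct ▸ norm_pos_iff.2 hc0
  -- The window `[i - n * g, i + n * B]` seen by `n` steps from `i` is then exactly the block `J +
  -- t`, of length `L = n * (g + B) + 1`.
  set i := (J + t) * L + n * g with hi
  have hiJ : J ≤ i := by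
    have : J + t ≤ (J + t) * L := Nat.le_mul_of_pos_right _ (Nat.succ_pos _)
    omega
  have hloc : (T ^ n) h i = c t * (bandIter P B γ n i : ℂ) := by
    refine bandOp_pow_apply_of_local hP hB hγ hg (c t) h n i (Nat.le_add_left _ _) ?_
    intro x h1 h2
    have hx : x / L = J + t := by
      refine Nat.div_eq_of_lt_le (by omega) ?_
      rw [Nat.succ_mul, hL, mul_add n g B]
      rw [hi, hL, mul_add n g B] at h2
      omega
    rw [hh, blockMap_apply, hx]
    have : J + (t : ℕ) - J = t := Nat.add_sub_cancel_left _ _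
    rw [dif_pos (by rw [this]; exact t.2)]
    congr 2
    exact Fin.ext this
  refine ⟨i, hiJ, ?_⟩
  have hγi : 0 < γ ^ i := pow_pos (by linarith) i
  rw [div_le_iff₀ hγi]
  have h1 : ‖(T ^ n) h‖ ≤ ‖(T ^ n).comp H.subtypeL‖ * ‖h‖ :=
    ((T ^ n).comp H.subtypeL).le_opNorm ⟨h, hH⟩
  have h2 := BSpace.norm_apply_le ((T ^ n) h) i
  rw [hloc, norm_mul, Complex.norm_real, Real.norm_of_nonneg (bandIter_nonneg hP hγ n i)] at h2
  have h3 : ‖h‖ ≤ ‖c t‖ := hct ▸ norm_blockMap_le hγ L J k c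
  have h4 : ‖c t‖ * bandIter P B γ n i
      ≤ ‖c t‖ * (‖(T ^ n).comp H.subtypeL‖ * γ ^ i) := by
    refine h2.trans ?_
    change ‖(T ^ n) h‖ * γ ^ i ≤ _
    calc ‖(T ^ n) h‖ * γ ^ i ≤ (‖(T ^ n).comp H.subtypeL‖ * ‖c t‖) * γ ^ i :=
          mul_le_mul_of_nonneg_right
            (h1.trans (mul_le_mul_of_nonneg_left h3 (ContinuousLinearMap.opNorm_nonneg _))) hγi.le
      _ = _ := by ring
  exact le_of_mul_le_mul_left h4 hcpos

end Band

/-! ### From asymptotic ratios to the drift inequality -/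

section Drift

theorem driftBound_of_eventually {P : ℕ → ℕ → ℝ} {B : ℕ} (hP : IsMarkov P)
    (hB : ∀ i j, i + B < j → P i j = 0) {γ : ℝ} (hγ : 1 < γ) {N : ℕ} (hN : 1 ≤ N) {δ : ℝ} (hδ : 0 ≤ δ)
    (h : ∀ᶠ i in atTop, bandIter P B γ N i ≤ δ ^ N * γ ^ i) :
    DriftBound P (geomWeight γ hγ) δ := by
  obtain ⟨m, hm⟩ := eventually_atTop.1 h
  have hnn := bandIter_nonneg (B := B) hP hγ N
  have hsum := Finset.sum_nonneg fun i (_ : i ∈ Finset.range m) => hnn i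
  -- The sum covers the finitely many states below `m`; the summand `1` keeps `b` positive.
  refine ⟨N, hN, 1 + ∑ i ∈ Finset.range m, bandIter P B γ N i, by linarith, fun i => ?_⟩
  rw [powAct_eq_bandIter hP hB hγ]
  refine ENNReal.ofReal_le_ofReal ?_
  change _ ≤ δ ^ N * γ ^ i + _
  by_cases hi : m ≤ i
  · linarith [hm i hi]
  · have h1 := Finset.single_le_sum (fun i _ => hnn i) (Finset.mem_range.2 (not_le.1 hi))
    have h2 : 0 ≤ δ ^ N * γ ^ i := mul_nonneg (pow_nonneg hδ N) (pow_nonneg (by linarith) i)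
    linarith

end Drift

/-! ### Random walks with bounded increments -/

section Walk

variable {c g d : ℕ} {P : ℕ → ℕ → ℝ} {a : ℤ → ℕ → ℝ}

/-- The bound `c + d` serves both regimes: from `i < g` the states up to `c` already carry all the
mass, and from `i ≥ g` jumps are at most `d`. -/
theorem IsBoundedIncrementWalk.upper_band (hP : IsBoundedIncrementWalk c g d P a) (i j : ℕ)
    (hj : i + (c + d) < j) : P i j = 0 := by
  rcases lt_or_ge i g with hi | hi
  · have h1 := sum_le_hasSum (insert j (Finset.range (c + 1)))
      (fun k _ => hP.markov.nonneg i k) (hP.markov.hasSum_one i)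
    rw [Finset.sum_insert (by rw [Finset.mem_range]; omega), hP.boundary i hi] at h1
    linarith [hP.markov.nonneg i j]
  · rw [hP.interior i hi, if_neg (by omega)]

theorem IsBoundedIncrementWalk.lower_band (hP : IsBoundedIncrementWalk c g d P a) (i j : ℕ)
    (hi : g ≤ i) (hj : j + g < i) : P i j = 0 := by
  rw [hP.interior i hi, if_neg (by omega)]

theorem IsBoundedIncrementWalk.sum_band (hP : IsBoundedIncrementWalk c g d P a) {i : ℕ}
    (hi : g ≤ i) (F : ℕ → ℝ) :
    ∑ j ∈ Finset.range (i + (c + d) + 1), P i j * F j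
      = ∑ k ∈ Finset.Icc (-(g : ℤ)) (d : ℤ), a k i * F ((i : ℤ) + k).toNat := by
  symm
  refine Finset.sum_of_injOn (fun k : ℤ => ((i : ℤ) + k).toNat) ?_ ?_ ?_ ?_
  · intro k hk l hl hkl
    simp only [Finset.coe_Icc, Set.mem_Icc] at hk hl hkl
    omega
  · intro k hk
    simp only [Finset.coe_Icc, Set.mem_Icc, Finset.coe_range, Set.mem_Iio] at hk ⊢
    omega
  · intro j _ hj
    rw [hP.interior i hi, if_neg, zero_mul]
    intro h
    refine hj ⟨(j : ℤ) - i, ?_, ?_⟩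
    · simp only [Finset.coe_Icc, Set.mem_Icc]
      omega
    · simp
  · intro k hk
    rw [Finset.mem_Icc] at hk
    have h1 : ((((i : ℤ) + k).toNat : ℕ) : ℤ) = i + k := Int.toNat_of_nonneg (by omega)
    rw [hP.interior i hi, if_pos (by omega), h1]
    congr 2
    ring

theorem IsBoundedIncrementWalk.bandIter_succ_div (hP : IsBoundedIncrementWalk c g d P a)
    {γ : ℝ} (hγ : 1 < γ) (n : ℕ) {i : ℕ} (hi : g ≤ i) :
    bandIter P (c + d) γ (n + 1) i / γ ^ i
      = ∑ k ∈ Finset.Icc (-(g : ℤ)) (d : ℤ), a k i * γ ^ k *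
        (bandIter P (c + d) γ n ((i : ℤ) + k).toNat / γ ^ ((i : ℤ) + k).toNat) := by
  have hγ0 : γ ≠ 0 := by linarith
  rw [bandIter, hP.sum_band hi, Finset.sum_div]
  refine Finset.sum_congr rfl fun k hk => ?_
  rw [Finset.mem_Icc] at hk
  have h1 : ((((i : ℤ) + k).toNat : ℕ) : ℤ) = i + k := Int.toNat_of_nonneg (by omega)
  have h2 : γ ^ ((i : ℤ) + k).toNat = γ ^ i * γ ^ k := by
    rw [← zpow_natCast, h1, zpow_add₀ hγ0, zpow_natCast]
  have h3 : γ ^ k ≠ 0 := zpow_ne_zero k hγ0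
  have h4 : γ ^ i ≠ 0 := pow_ne_zero i hγ0
  rw [h2]
  field_simp

theorem IsBoundedIncrementWalk.tendsto_bandIter_div (hP : IsBoundedIncrementWalk c g d P a)
    {α : ℤ → ℝ} (hlim : ∀ k ∈ Finset.Icc (-(g : ℤ)) (d : ℤ), Tendsto (a k) atTop (𝓝 (α k)))
    {γ : ℝ} (hγ : 1 < γ) (n : ℕ) :
    Tendsto (fun i => bandIter P (c + d) γ n i / γ ^ i) atTop (𝓝 (phi g d α γ ^ n)) := by
  induction n with
  | zero =>
    rw [pow_zero]
    refine tendsto_const_nhds.congr fun i => ?_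
    rw [bandIter, div_self (pow_ne_zero i (by linarith))]
  | succ n ih =>
    rw [pow_succ', phi, Finset.sum_mul]
    refine Tendsto.congr' ?_ (tendsto_finsetSum _ fun k hk =>
      (((hlim k hk).mul_const (γ ^ k)).mul (ih.comp (?_ :
        Tendsto (fun i : ℕ => ((i : ℤ) + k).toNat) atTop atTop))))
    · filter_upwards [eventually_ge_atTop g] with i hi
      exact (hP.bandIter_succ_div hγ n hi).symm
    · refine tendsto_atTop_mono (f := fun i : ℕ => i - k.natAbs) (fun i => by omega) ?_
      exact tendsto_sub_atTop_nat _

/-- The limits still sum to `1`, so they cannot all vanish. Positivity is needed because the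
admissible levels `r₀` and `δ` are. -/
theorem IsBoundedIncrementWalk.phi_pos (hP : IsBoundedIncrementWalk c g d P a) {α : ℤ → ℝ}
    (hα : ∀ k ∈ Finset.Icc (-(g : ℤ)) (d : ℤ), α k ∈ Set.Icc (0 : ℝ) 1)
    (hlim : ∀ k ∈ Finset.Icc (-(g : ℤ)) (d : ℤ), Tendsto (a k) atTop (𝓝 (α k)))
    {γ : ℝ} (hγ : 1 < γ) : 0 < phi g d α γ := by
  have hγ0 : 0 < γ := by linarith
  have hsum : ∑ k ∈ Finset.Icc (-(g : ℤ)) (d : ℤ), α k = 1 := by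
    refine tendsto_nhds_unique (tendsto_finsetSum _ hlim) (tendsto_const_nhds.congr' ?_)
    filter_upwards [eventually_ge_atTop g] with i hi
    exact (hP.coeff_sum i hi).symm
  have hnn : ∀ k ∈ Finset.Icc (-(g : ℤ)) (d : ℤ), 0 ≤ α k * γ ^ k := fun k hk =>
    mul_nonneg (hα k hk).1 (zpow_pos hγ0 k).le
  refine (Finset.sum_nonneg hnn).lt_of_ne fun h0 => ?_
  have hz := (Finset.sum_eq_zero_iff_of_nonneg hnn).1 h0.symm
  rw [Finset.sum_eq_zero fun k hk => (mul_eq_zero.1 (hz k hk)).resolve_right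
    (zpow_pos hγ0 k).ne'] at hsum
  exact zero_ne_one hsum

theorem IsBoundedIncrementWalk.eventually_bandIter_le (hP : IsBoundedIncrementWalk c g d P a)
    {α : ℤ → ℝ} (hlim : ∀ k ∈ Finset.Icc (-(g : ℤ)) (d : ℤ), Tendsto (a k) atTop (𝓝 (α k)))
    {γ : ℝ} (hγ : 1 < γ) {n : ℕ} {ρ : ℝ} (hρ : phi g d α γ ^ n < ρ) :
    ∀ᶠ i in atTop, bandIter P (c + d) γ n i ≤ ρ * γ ^ i := by
  filter_upwards [(hP.tendsto_bandIter_div hlim hγ n).eventually_le_const hρ] with i hi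
  exact (div_le_iff₀ (pow_pos (by linarith) i)).1 hi

/-- Divide by `V` and let the state tend to infinity: the constant `b` disappears. -/
theorem IsBoundedIncrementWalk.phi_le_of_driftBound (hP : IsBoundedIncrementWalk c g d P a)
    {α : ℤ → ℝ} (hlim : ∀ k ∈ Finset.Icc (-(g : ℤ)) (d : ℤ), Tendsto (a k) atTop (𝓝 (α k)))
    {γ : ℝ} (hγ : 1 < γ) {δ : ℝ} (hδ : 0 ≤ δ) (h : DriftBound P (geomWeight γ hγ) δ) :
    phi g d α γ ≤ δ := by
  obtain ⟨N, hN, b, hb, hle⟩ := h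
  have h1 : Tendsto (fun i : ℕ => δ ^ N + b * (γ⁻¹) ^ i) atTop (𝓝 (δ ^ N + b * 0)) :=
    ((tendsto_pow_atTop_nhds_zero_of_lt_one (inv_nonneg.2 (by linarith))
      (inv_lt_one_of_one_lt₀ hγ)).const_mul b).const_add _
  rw [mul_zero, add_zero] at h1
  have h2 : phi g d α γ ^ N ≤ δ ^ N := by
    refine le_of_tendsto_of_tendsto' (hP.tendsto_bandIter_div hlim hγ N) h1 fun i => ?_
    have hγi : 0 < γ ^ i := pow_pos (by linarith) i
    have h3 := hle i
    rw [powAct_eq_bandIter hP.markov hP.upper_band hγ, ENNReal.ofReal_le_ofReal_iff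
      (add_nonneg (mul_nonneg (pow_nonneg hδ N) ((geomWeight γ hγ).pos i).le) hb.le)] at h3
    rw [div_le_iff₀ hγi, add_mul, inv_pow, mul_assoc, inv_mul_cancel₀ hγi.ne', mul_one]
    exact h3
  exact le_of_pow_le_pow_left₀ (by omega) hδ h2

theorem IsBoundedIncrementWalk.driftL_eq (hP : IsBoundedIncrementWalk c g d P a) {α : ℤ → ℝ}
    (hlim : ∀ k ∈ Finset.Icc (-(g : ℤ)) (d : ℤ), Tendsto (a k) atTop (𝓝 (α k)))
    {γ : ℝ} (hγ : 1 < γ) (hφ : 0 ≤ phi g d α γ) :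
    driftL P (geomWeight γ hγ) = ENNReal.ofReal (phi g d α γ) := by
  have h1 : ∀ N : ℕ, driftLimsup P (geomWeight γ hγ) N = ENNReal.ofReal (phi g d α γ ^ N) := by
    intro N
    refine Tendsto.limsup_eq ((ENNReal.tendsto_ofReal
      (hP.tendsto_bandIter_div hlim hγ N)).congr fun i => ?_)
    rw [powAct_eq_bandIter hP.markov hP.upper_band hγ]
    exact ENNReal.ofReal_div_of_pos ((geomWeight γ hγ).pos i)
  have h2 : ∀ N : ℕ+, driftLimsup P (geomWeight γ hγ) N ^ (1 / ((N : ℕ) : ℝ))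
      = ENNReal.ofReal (phi g d α γ) := by
    intro N
    rw [h1, ENNReal.ofReal_rpow_of_nonneg (pow_nonneg hφ _) (by positivity), one_div,
      Real.pow_rpow_inv_natCast hφ N.ne_zero]
  rw [driftL, iInf_congr h2, iInf_const]

theorem IsBoundedIncrementWalk.quasiCompactAt (hP : IsBoundedIncrementWalk c g d P a)
    {α : ℤ → ℝ} (hlim : ∀ k ∈ Finset.Icc (-(g : ℤ)) (d : ℤ), Tendsto (a k) atTop (𝓝 (α k)))
    {γ : ℝ} (hγ : 1 < γ) (hφ : 0 < phi g d α γ) {r₀ : ℝ} (hr : phi g d α γ < r₀) (hr1 : r₀ ≤ 1) :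
    QuasiCompactAt (bandOp hP.markov hP.upper_band hγ) r₀ := by
  obtain ⟨s, hs1, hs2⟩ := exists_between hr
  have hs : 0 < s := hφ.trans hs1
  have hr0 : 0 < r₀ := hφ.trans hr
  -- A high power gives `2 * s ^ (n + 1) < r₀ ^ (n + 1)`, so the factor `2` from the Riesz argument
  -- costs nothing in the limit.
  obtain ⟨n, hn⟩ := exists_pow_lt_of_lt_one (show (0 : ℝ) < 1 / 2 by norm_num)
    ((div_lt_one hr0).2 hs2)
  have hn' : (s / r₀) ^ (n + 1) < 1 / 2 :=
    (pow_le_pow_of_le_one (by positivity) ((div_lt_one hr0).2 hs2).le (Nat.le_succ n)).trans_lt hn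
  rw [div_pow, div_lt_iff₀ (pow_pos hr0 _)] at hn'
  exact quasiCompactAt_bandOp hP.markov hP.upper_band hγ (N := n + 1) (Nat.succ_pos n) hr0 hr1
    (pow_pos hs (n + 1)).le (by linarith)
    (hP.eventually_bandIter_le hlim hγ (pow_lt_pow_left₀ hs1 hφ.le (Nat.succ_ne_zero n)))

theorem IsBoundedIncrementWalk.phi_lt_of_quasiCompactAt (hP : IsBoundedIncrementWalk c g d P a)
    {α : ℤ → ℝ} (hlim : ∀ k ∈ Finset.Icc (-(g : ℤ)) (d : ℤ), Tendsto (a k) atTop (𝓝 (α k)))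
    {γ : ℝ} (hγ : 1 < γ) (hφ : 0 ≤ phi g d α γ) {r₀ : ℝ}
    (h : QuasiCompactAt (bandOp hP.markov hP.upper_band hγ) r₀) : phi g d α γ < r₀ := by
  obtain ⟨H, hH, hlt⟩ := exists_finite_codim_of_quasiCompactAt h
  refine lt_of_le_of_lt (le_ciInf fun n => ?_) hlt
  have h1 := le_norm_bandOp_pow_comp hP.markov hP.upper_band hγ hP.lower_band H
    (hP.tendsto_bandIter_div hlim hγ n)
  calc phi g d α γ = (phi g d α γ ^ (n : ℕ)) ^ (1 / ((n : ℕ) : ℝ)) := by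
        rw [one_div, Real.pow_rpow_inv_natCast hφ n.ne_zero]
    _ ≤ _ := Real.rpow_le_rpow (pow_nonneg hφ _) h1 (by positivity)

/-- The admissible levels are exactly those in `(φ(γ), 1)`; the infimum is not attained. -/
theorem IsBoundedIncrementWalk.essSpectralRadius_eq (hP : IsBoundedIncrementWalk c g d P a)
    {α : ℤ → ℝ} (hlim : ∀ k ∈ Finset.Icc (-(g : ℤ)) (d : ℤ), Tendsto (a k) atTop (𝓝 (α k)))
    {γ : ℝ} (hγ : 1 < γ) (hφ : 0 < phi g d α γ) (hφ1 : phi g d α γ < 1) :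
    essSpectralRadius (bandOp hP.markov hP.upper_band hγ) = phi g d α γ := by
  refine csInf_eq_of_forall_ge_of_forall_gt_exists_lt ?_ ?_ ?_
  · obtain ⟨r, hr1, hr2⟩ := exists_between hφ1
    exact ⟨r, hφ.trans hr1, hr2, hP.quasiCompactAt hlim hγ hφ hr1 hr2.le⟩
  · rintro r ⟨-, -, hr⟩
    exact (hP.phi_lt_of_quasiCompactAt hlim hγ hφ.le hr).le
  · intro w hw
    obtain ⟨r, hr1, hr2⟩ := exists_between (lt_min hw hφ1)
    rw [lt_min_iff] at hr2
    exact ⟨r, ⟨hφ.trans hr1, hr2.2, hP.quasiCompactAt hlim hγ hφ hr1 hr2.2.le⟩, hr2.1⟩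

end Walk

end MarkovSpectral

theorem proposition4 (c g d : ℕ) (hc : 1 ≤ c) (hg : 1 ≤ g) (hd : 1 ≤ d)
    (P : ℕ → ℕ → ℝ) (a : ℤ → ℕ → ℝ) (hP : IsBoundedIncrementWalk c g d P a)
    (α : ℤ → ℝ)
    (hα : ∀ k ∈ Finset.Icc (-(g : ℤ)) (d : ℤ), α k ∈ Set.Icc (0 : ℝ) 1)
    (hlim : ∀ k ∈ Finset.Icc (-(g : ℤ)) (d : ℤ), Tendsto (a k) atTop (𝓝 (α k)))
    (γ : ℝ) (hγ : 1 < γ) (hφ : phi g d α γ < 1) :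
    -- the weak drift condition, at every level above `φ(γ)`, with optimal level `φ(γ)`
    (∀ δ : ℝ, phi g d α γ < δ → δ < 1 → WeakDrift P (geomWeight γ hγ) δ) ∧
    driftInf P (geomWeight γ hγ) = phi g d α γ ∧
    -- the level `φ(γ)` itself is attained if `φ_n(γ) ≤ φ(γ)` for all large `n`
    ((∀ᶠ n in atTop, phi g d (fun k => a k n) γ ≤ phi g d α γ) →
      WeakDrift P (geomWeight γ hγ) (phi g d α γ)) ∧
    -- the spectral properties of the operator induced by `P`
    ∃ T : BSpace (geomWeight γ hγ) →L[ℂ] BSpace (geomWeight γ hγ),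
      IsActionOf P T ∧ PowerBounded T ∧ QuasiCompact T ∧
      essSpectralRadius T = phi g d α γ ∧
      driftL P (geomWeight γ hγ) = ENNReal.ofReal (phi g d α γ) := by
  have hpos : 0 < phi g d α γ := hP.phi_pos hα hlim hγ
  have hdrift : ∀ δ : ℝ, phi g d α γ < δ → DriftBound P (geomWeight γ hγ) δ := fun δ hδ =>
    driftBound_of_eventually hP.markov hP.upper_band hγ le_rfl (hpos.trans hδ).le
      (hP.eventually_bandIter_le hlim hγ (pow_lt_pow_left₀ hδ hpos.le one_ne_zero))
  refine ⟨fun δ hδ hδ1 => ⟨hpos.trans hδ, hδ1, hdrift δ hδ⟩, ?_, fun hev => ⟨hpos, hφ, ?_⟩,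
    bandOp hP.markov hP.upper_band hγ, isActionOf_bandOp _ _ _, ?_, ?_,
    hP.essSpectralRadius_eq hlim hγ hpos hφ, hP.driftL_eq hlim hγ hpos.le⟩
  · refine csInf_eq_of_forall_ge_of_forall_gt_exists_lt ?_ ?_ ?_
    · obtain ⟨r, hr1, hr2⟩ := exists_between hφ
      exact ⟨r, (hpos.trans hr1).le, hr2, hdrift r hr1⟩
    · rintro δ ⟨hδ, -, h⟩
      exact hP.phi_le_of_driftBound hlim hγ hδ h
    · intro w hw
      obtain ⟨r, hr1, hr2⟩ := exists_between (lt_min hw hφ)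
      rw [lt_min_iff] at hr2
      exact ⟨r, ⟨(hpos.trans hr1).le, hr2.2, hdrift r hr1⟩, hr2.1⟩
  · refine driftBound_of_eventually hP.markov hP.upper_band hγ le_rfl hpos.le ?_
    filter_upwards [hev, eventually_ge_atTop g] with i hi hgi
    have hγi : 0 < γ ^ i := pow_pos (by linarith) i
    -- For one step the ratio `P V / V` at `i ≥ g` is exactly `φ_i(γ)`, so no margin above `φ(γ)` is
    -- lost.
    rw [pow_one, ← div_le_iff₀ hγi, hP.bandIter_succ_div hγ 0 hgi]
    refine le_trans (le_of_eq (Finset.sum_congr rfl fun k _ => ?_)) hi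
    rw [bandIter, div_self (pow_ne_zero _ (by linarith)), mul_one]
  · obtain ⟨δ, hδ1, hδ2⟩ := exists_between hφ
    obtain ⟨m, hm⟩ := eventually_atTop.1 (hP.eventually_bandIter_le hlim hγ (n := 1) (ρ := δ)
      (by rwa [pow_one]))
    have hnn := bandIter_nonneg (B := c + d) hP.markov hγ 1
    refine powerBounded_bandOp hP.markov hP.upper_band hγ (hpos.trans hδ1).le hδ2
      (b := ∑ i ∈ Finset.range m, bandIter P (c + d) γ 1 i)
      (Finset.sum_nonneg fun i _ => hnn i) fun i => ?_
    have hδi : 0 ≤ δ * γ ^ i := mul_nonneg (hpos.trans hδ1).le (pow_nonneg (by linarith) i)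
    by_cases hi : m ≤ i
    · linarith [hm i hi, Finset.sum_nonneg fun i (_ : i ∈ Finset.range m) => hnn i]
    · linarith [Finset.single_le_sum (fun i _ => hnn i) (Finset.mem_range.2 (not_le.1 hi))]
  · obtain ⟨r, hr1, hr2⟩ := exists_between hφ
    exact ⟨r, hpos.trans hr1, hr2, hP.quasiCompactAt hlim hγ hpos hr1 hr2.le⟩
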